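/- Let $n\ge 4$, let $G=\mathsf C_{2^n}=\mathbb Z/2^n\mathbb Z$ (written additively), let $\rho(g)\colon x\mapsto x+g$ be the right regular representation, and let $\mathrm{Hol}(G)=\langle\rho(G),\mathrm{Aut}(G)\rangle\le \mathrm{Sym}(G)$. The local normalizing graph of $G$ has as vertices the regular subgroups of $\mathrm{Hol}(G)$; two distinct vertices $N,M$ are joined by an edge if and only if $N$ and $M$ normalize each other in $\mathrm{Sym}(G)$. Permutations and automorphisms act on the right. A gamma function is a map $\gamma\colon G\to\mathrm{Aut}(G)$ with $\gamma(g^{\gamma(h)}+h)=\gamma(g)\gamma(h)$ for all $g,h\in G$; its associated subgroup is $\{\gamma(g)\rho(g): g\in G\}$. For odd $a$ let $\sigma_a\in\mathrm{Aut}(G)$ be $x\mapsto ax$. The following maps are gamma functions: $\gamma_1(x)=\sigma_1$, $\gamma_2(x)=\sigma_{2^{n-1}+1}^x$, $\gamma_3(x)=\sigma_{2^{n-1}-1}^x$, $\gamma_4(x)=\sigma_{2^n-1}^x$; $\gamma_5(x)=\sigma_1,\sigma_{2^{n-1}-1},\sigma_{2^{n-1}+1},\sigma_{2^n-1}$ and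 $\gamma_6(x)=\sigma_1,\sigma_{2^n-1},\sigma_{2^{n-1}+1},\sigma_{2^{n-1}-1}$ for $x\equiv 0,1,2,3 \pmod 4$ respectively; $\gamma_{\mathsf p}(x)=\sigma_{2x+1}$; $\gamma_{\mathsf m}(x)=\sigma_{2x+1}$ for $x$ even and $\sigma_{2x+2^{n-2}+1}$ for $x$ odd; and $\gamma_{\mathsf c,u}(x)=\sigma_{2^ux+1}$ for $2\le u\le n$. Let $N_1,\dots,N_6,N_{\mathsf p},N_{\mathsf m},N_{\mathsf c,u}$ be the associated subgroups. For an integer $k\ge 0$ let $N^k$ be the conjugate of $N$ under $\sigma_{2k+1}^{-1}$, and write $N_{\mathsf p}^k,N_{\mathsf m}^k,N_{\mathsf c,u}^k$ accordingly. **Vertices.** The regular subgroups of $\mathrm{Hol}(G)$ are exactly $N_1,\dots,N_6$, the $N_{\mathsf p}^k$, the $N_{\mathsf m}^k$ and the $N_{\mathsf c,u}^k$, where $0\le k<2^{n-1}$ and $2\le u\le n$. Each $N_{\mathsf c,u}^k$ is cyclic, and $N_{\mathsf c,n}^k=N_1$, $N_{\mathsf c,n-1}^k=N_2$ for all $k$.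 The groups $N_3,N_4,N_5,N_6$ are distinct, and the four families $\{N_3,\dots,N_6\}$, $\{N_{\mathsf p}^k\}$, $\{N_{\mathsf m}^k\}$, $\{N_{\mathsf c,u}^k\}$ are pairwise disjoint. Moreover $N_{\mathsf p}^k=N_{\mathsf p}^h$ if and only if $k\equiv h\pmod{2^{n-2}}$, the same holds for $N_{\mathsf m}$, and $N_{\mathsf c,u}^k=N_{\mathsf c,v}^h$ if and only if $u=v$ and either $u=n$ or $k\equiv h\pmod{2^{n-u-1}}$. **Edges.** Two distinct vertices are joined by an edge if and only if they lie together in one of the following sets (which are therefore cliques): 1. $\{N_1,N_2,N_3,N_4\}$ and $\{N_3,N_4,N_5,N_6\}$; 2. $H=\{N_{\mathsf c,u}^k:\ \lceil n/2\rceil\le u\le n,\ 0\le k<2^{n-1}\}$, which contains $N_1$ and $N_2$ and has exactly $2^{n-\lceil n/2\rceil}$ elements; 3. $S_k=\{N_{\mathsf p}^{k},\,N_{\mathsf m}^{k+2^{n-4}},\,N_{\mathsf p}^{k+2^{n-3}},\,N_{\mathsf m}^{k+2^{n-3}+2^{n-4}}\}$ for $0\le k<2^{n-1}$, each with exactly $4$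 elements; 4. $A_u^t=\{N_{\mathsf c,u}^k:\ 0\le k<2^{n-1},\ k\equiv t\pmod{2^{n-2u-1}}\}$ for $2\le u<\lceil n/2\rceil$ and $0\le t<2^{n-2u-1}$, each with exactly $2^u$ elements. -/

import Mathlib

namespace CyclicHol

open Equiv

section General

variable {G : Type*} [AddGroup G]

/-- The permutational holomorph of a group `G` (written additively): the subgroup of `Sym(G)`
generated by the right translations `x ↦ x + g` and the automorphisms of `G`. -/
def hol (G : Type*) [AddGroup G] : Subgroup (Perm G) :=
  Subgroup.closure
    (Set.range (fun g : G => Equiv.addRight g) ∪ Set.range (fun α : G ≃+ G => α.toEquiv))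

/-- A permutation group on `X` is regular if for all `x`, `y` exactly one of its elements
maps `x` to `y`. -/
def IsRegularSubgroup {X : Type*} (N : Subgroup (Perm X)) : Prop :=
  ∀ x y : X, ∃! f : Perm X, f ∈ N ∧ f x = y

/-- The vertices of the local normalizing graph: the regular subgroups of the holomorph. -/
def regularSubgroups (G : Type*) [AddGroup G] : Set (Subgroup (Perm G)) :=
  {N | N ≤ hol G ∧ IsRegularSubgroup N}

/-- The local normalizing graph of `G`: two distinct regular subgroups of the holomorph are joined
by an edge if and only if they normalize each other in `Sym(G)`. -/
def localNormalizingGraph (G : Type*) [AddGroup G] : SimpleGraph (regularSubgroups G) where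
  Adj N M := N ≠ M ∧ N.1 ≤ Subgroup.normalizer (M.1 : Set (Perm G)) ∧
    M.1 ≤ Subgroup.normalizer (N.1 : Set (Perm G))
  symm := ⟨fun _ _ h => ⟨h.1.symm, h.2.2, h.2.1⟩⟩
  loopless := ⟨fun _ h => h.1 rfl⟩

/-- The gamma functional equation `γ(g^{γ(h)} + h) = γ(g) γ(h)`. Automorphisms act on the right, so
the product `γ(g) γ(h)` is `γ(g)` followed by `γ(h)`. -/
def IsGammaFunction (γ : G → (G ≃+ G)) : Prop :=
  ∀ g h : G, γ (γ h g + h) = (γ g).trans (γ h)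

/-- The permutation `ν(g) = γ(g) ρ(g)`, that is `x ↦ x^{γ(g)} + g`. -/
def nu (γ : G → (G ≃+ G)) (g : G) : Perm G :=
  (γ g).toEquiv.trans (Equiv.addRight g)

theorem nu_apply (γ : G → (G ≃+ G)) (g x : G) : nu γ g x = γ g x + g := rfl

/-- The subgroup of `Sym(G)` associated with `γ`. It is generated by the permutations `ν(g)`, and
consists exactly of them when `γ` is a gamma function (see `coe_assocSubgroup`). -/
def assocSubgroup (γ : G → (G ≃+ G)) : Subgroup (Perm G) :=
  Subgroup.closure (Set.range (nu γ))

theorem coe_assocSubgroup {γ : G → (G ≃+ G)} (hγ : IsGammaFunction γ) :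
    (assocSubgroup γ : Set (Perm G)) = Set.range (nu γ) := by
  have hmul : ∀ g h, nu γ h * nu γ g = nu γ (γ h g + h) := by
    intro g h
    ext x
    rw [Perm.mul_apply, nu_apply, nu_apply, nu_apply, hγ g h, map_add, add_assoc]
    rfl
  have h0 : nu γ 0 = 1 := by
    have h := hmul 0 0
    rw [map_zero, add_zero] at h
    exact mul_eq_right.mp h
  have hinv : ∀ g, ∃ g', nu γ g' = (nu γ g)⁻¹ := by
    intro g
    refine ⟨(γ g).symm (-g), ?_⟩
    rw [eq_inv_iff_mul_eq_one, ← inv_eq_iff_mul_eq_one, inv_eq_iff_mul_eq_one, mul_eq_one_iff_eq_inv,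
      eq_inv_iff_mul_eq_one.trans (mul_eq_one_comm)]
    rw [hmul, AddEquiv.apply_symm_apply, neg_add_cancel, h0]
  let S : Subgroup (Perm G) :=
    { carrier := Set.range (nu γ)
      mul_mem' := by
        rintro _ _ ⟨h, rfl⟩ ⟨g, rfl⟩
        exact ⟨_, (hmul g h).symm⟩
      one_mem' := ⟨0, h0⟩
      inv_mem' := by
        rintro _ ⟨g, rfl⟩
        exact hinv g }
  have : assocSubgroup γ = S := Subgroup.closure_eq S
  rw [this]
  rfl

/-- The conjugate `N^α = α⁻¹ N α` of a permutation group under an automorphism `α` of `G`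
(permutations act on the right, so `α⁻¹ n α` is the function `x ↦ α (n (α⁻¹ x))`). -/
def conjSubgroup (N : Subgroup (Perm G)) (α : G ≃+ G) : Subgroup (Perm G) :=
  N.map (MulAut.conj α.toEquiv).toMonoidHom

end General

/-- The cyclic group `C_{2^n}`, written additively. -/
abbrev C (n : ℕ) : Type := ZMod (2 ^ n)

open Classical in
/-- The automorphism `σ_a : x ↦ a x` of `C_{2^n}`, for `a` odd (a unit). It is only used for such
`a`; the value at non-units is irrelevant. -/
noncomputable def sigma {n : ℕ} (a : C n) : C n ≃+ C n :=
  if h : IsUnit a then DistribMulAction.toAddEquiv (C n) h.unit else AddEquiv.refl _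

theorem sigma_apply {n : ℕ} {a : C n} (h : IsUnit a) (x : C n) : sigma a x = a * x := by
  unfold sigma
  rw [dif_pos h]
  rfl

/-! The gamma functions. Note `σ_a^x = σ_{a^x}`. -/

noncomputable def gamma1 (n : ℕ) (_x : C n) : C n ≃+ C n := sigma 1

noncomputable def gamma2 (n : ℕ) (x : C n) : C n ≃+ C n := sigma ((2 ^ (n - 1) + 1) ^ x.val)

noncomputable def gamma3 (n : ℕ) (x : C n) : C n ≃+ C n := sigma ((2 ^ (n - 1) - 1) ^ x.val)

noncomputable def gamma4 (n : ℕ) (x : C n) : C n ≃+ C n := sigma ((2 ^ n - 1) ^ x.val)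

noncomputable def gamma5 (n : ℕ) (x : C n) : C n ≃+ C n :=
  match x.val % 4 with
  | 0 => sigma 1
  | 1 => sigma (2 ^ (n - 1) - 1)
  | 2 => sigma (2 ^ (n - 1) + 1)
  | _ => sigma (2 ^ n - 1)

noncomputable def gamma6 (n : ℕ) (x : C n) : C n ≃+ C n :=
  match x.val % 4 with
  | 0 => sigma 1
  | 1 => sigma (2 ^ n - 1)
  | 2 => sigma (2 ^ (n - 1) + 1)
  | _ => sigma (2 ^ (n - 1) - 1)

noncomputable def gammaP (n : ℕ) (x : C n) : C n ≃+ C n := sigma (2 * x + 1)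

noncomputable def gammaM (n : ℕ) (x : C n) : C n ≃+ C n :=
  if x.val % 2 = 0 then sigma (2 * x + 1) else sigma (2 * x + 2 ^ (n - 2) + 1)

noncomputable def gammaC (n u : ℕ) (x : C n) : C n ≃+ C n := sigma (2 ^ u * x + 1)

/-! The associated subgroups of `Sym(C_{2^n})`. -/

noncomputable def N1 (n : ℕ) : Subgroup (Perm (C n)) := assocSubgroup (gamma1 n)
noncomputable def N2 (n : ℕ) : Subgroup (Perm (C n)) := assocSubgroup (gamma2 n)
noncomputable def N3 (n : ℕ) : Subgroup (Perm (C n)) := assocSubgroup (gamma3 n)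
noncomputable def N4 (n : ℕ) : Subgroup (Perm (C n)) := assocSubgroup (gamma4 n)
noncomputable def N5 (n : ℕ) : Subgroup (Perm (C n)) := assocSubgroup (gamma5 n)
noncomputable def N6 (n : ℕ) : Subgroup (Perm (C n)) := assocSubgroup (gamma6 n)

/-- `N^k` is the conjugate of `N` under `σ_{2k+1}⁻¹`. -/
noncomputable def conjK {n : ℕ} (N : Subgroup (Perm (C n))) (k : ℕ) : Subgroup (Perm (C n)) :=
  conjSubgroup N (sigma (2 * (k : C n) + 1)).symm

noncomputable def NP (n k : ℕ) : Subgroup (Perm (C n)) := conjK (assocSubgroup (gammaP n)) k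
noncomputable def NM (n k : ℕ) : Subgroup (Perm (C n)) := conjK (assocSubgroup (gammaM n)) k
noncomputable def NC (n u k : ℕ) : Subgroup (Perm (C n)) := conjK (assocSubgroup (gammaC n u)) k

def familyP (n : ℕ) : Set (Subgroup (Perm (C n))) := {N | ∃ k < 2 ^ (n - 1), N = NP n k}
def familyM (n : ℕ) : Set (Subgroup (Perm (C n))) := {N | ∃ k < 2 ^ (n - 1), N = NM n k}
def familyC (n : ℕ) : Set (Subgroup (Perm (C n))) :=
  {N | ∃ u k, 2 ≤ u ∧ u ≤ n ∧ k < 2 ^ (n - 1) ∧ N = NC n u k}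

/-- `⌈n / 2⌉`. -/
def ceilHalf (n : ℕ) : ℕ := (n + 1) / 2

/-! The cliques. -/

def cliqueH (n : ℕ) : Set (Subgroup (Perm (C n))) :=
  {N | ∃ u k, ceilHalf n ≤ u ∧ u ≤ n ∧ k < 2 ^ (n - 1) ∧ N = NC n u k}

def cliqueS (n k : ℕ) : Set (Subgroup (Perm (C n))) :=
  {NP n k, NM n (k + 2 ^ (n - 4)), NP n (k + 2 ^ (n - 3)), NM n (k + 2 ^ (n - 3) + 2 ^ (n - 4))}

def cliqueA (n u t : ℕ) : Set (Subgroup (Perm (C n))) :=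
  {N | ∃ k < 2 ^ (n - 1), k ≡ t [MOD 2 ^ (n - 2 * u - 1)] ∧ N = NC n u k}

/-- All the listed cliques. -/
def cliques (n : ℕ) : Set (Set (Subgroup (Perm (C n)))) :=
  {{N1 n, N2 n, N3 n, N4 n}, {N3 n, N4 n, N5 n, N6 n}, cliqueH n} ∪
    {S | ∃ k < 2 ^ (n - 1), S = cliqueS n k} ∪
    {A | ∃ u t, 2 ≤ u ∧ u < ceilHalf n ∧ t < 2 ^ (n - 2 * u - 1) ∧ A = cliqueA n u t}

end CyclicHol

open CyclicHol

/-!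
A gamma function on `C n = ZMod (2 ^ n)` is `x ↦ σ_{c x}` for a unit-valued function `c`, here
called a multiplier, with `c (c h * g + h) = c g * c h`, and the regular subgroups of the holomorph
are exactly the groups associated with gamma functions.

If `c 1 ≡ 1 (mod 4)`, then already the value at `1` determines `c` and `c x = 1 + 4 d x`, because
`1` generates `C n` under the operation `(g, h) ↦ c h * g + h`. If `c 1 ≡ 3 (mod 4)`, the same
applies to `c` on the even residues, and the odd ones form a translate of them under that operation.
In both cases `c x = 1 + 2 b x + 2 w [x odd]`. For two such functions the equation defining a
multiplier, the equality of the associated groups and the normalization of one by the other all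
become congruences in the pairs `(w, b)`. Solving the first gives the list of vertices: `w` can be
taken to be `0` if `c 1 ≡ 1 (mod 4)`, and otherwise `b` odd gives `N_p^k` and `N_m^k` and `b` even
gives `N₃, …, N₆`. The other two give the coincidences and the edges.
-/

namespace CyclicHol

open Equiv

section GammaFunction

variable {G : Type*} [AddGroup G] {γ γ' : G → (G ≃+ G)}

theorem mem_hol_iff {f : Perm G} :
    f ∈ hol G ↔ ∃ (α : G ≃+ G) (g : G), ∀ x, f x = α x + g := by
  constructor
  · intro hf
    induction hf using Subgroup.closure_induction with
    | mem f hf =>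
      rcases hf with ⟨g, rfl⟩ | ⟨α, rfl⟩
      · exact ⟨AddEquiv.refl G, g, fun _ => rfl⟩
      · exact ⟨α, 0, fun x => (add_zero (α x)).symm⟩
    | one => exact ⟨AddEquiv.refl G, 0, fun x => (add_zero x).symm⟩
    | mul f f' _ _ hf hf' =>
      obtain ⟨α, g, hf⟩ := hf
      obtain ⟨α', g', hf'⟩ := hf'
      exact ⟨α'.trans α, α g' + g, fun x => by
        rw [Perm.mul_apply, hf', hf, map_add, add_assoc, AddEquiv.trans_apply]⟩
    | inv f _ hf =>
      obtain ⟨α, g, hf⟩ := hf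
      exact ⟨α.symm, α.symm (-g), fun x => by
        rw [Perm.inv_eq_iff_eq, hf, ← map_add, α.apply_symm_apply, neg_add_cancel_right]⟩
  · rintro ⟨α, g, hf⟩
    obtain rfl : f = Equiv.addRight g * α.toEquiv := Equiv.ext hf
    exact mul_mem (Subgroup.subset_closure (.inl ⟨g, rfl⟩))
      (Subgroup.subset_closure (.inr ⟨α, rfl⟩))

theorem nu_mem_assocSubgroup (γ : G → (G ≃+ G)) (g : G) : nu γ g ∈ assocSubgroup γ :=
  Subgroup.subset_closure ⟨g, rfl⟩

theorem assocSubgroup_le_hol (γ : G → (G ≃+ G)) : assocSubgroup γ ≤ hol G := by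
  rw [assocSubgroup, Subgroup.closure_le]
  rintro _ ⟨g, rfl⟩
  exact mem_hol_iff.2 ⟨γ g, g, nu_apply γ g⟩

theorem conjSubgroup_assocSubgroup (γ : G → (G ≃+ G)) (α : G ≃+ G) :
    conjSubgroup (assocSubgroup γ) α =
      assocSubgroup fun x => α.symm.trans ((γ (α.symm x)).trans α) := by
  have nu_comp : (nu fun x => α.symm.trans ((γ (α.symm x)).trans α)) ∘ α =
      (MulAut.conj α.toEquiv).toMonoidHom ∘ nu γ := by
    ext g x
    simp [nu_apply, Perm.mul_apply]
  rw [conjSubgroup, assocSubgroup, assocSubgroup, MonoidHom.map_closure, ← Set.range_comp,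
    ← nu_comp, α.surjective.range_comp]

theorem conj_nu_apply (γ γ' : G → (G ≃+ G)) (g h x : G) :
    (nu γ' h * nu γ g * (nu γ' h)⁻¹) x =
      (γ' h).symm.trans ((γ g).trans (γ' h)) x +
        (-(γ' h).symm.trans ((γ g).trans (γ' h)) h + γ' h g + h) := by
  obtain ⟨y, rfl⟩ := (nu γ' h).surjective x
  rw [Perm.mul_apply, Perm.inv_eq_iff_eq.2 rfl, Perm.mul_apply]
  simp [nu_apply, add_assoc]

namespace IsGammaFunction

theorem mem_assocSubgroup_iff (hγ : IsGammaFunction γ) {f : Perm G} :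
    f ∈ assocSubgroup γ ↔ ∃ g, nu γ g = f := by
  rw [← SetLike.mem_coe, coe_assocSubgroup hγ, Set.mem_range]

theorem mem_assocSubgroup_iff_of_apply (hγ : IsGammaFunction γ) {f : Perm G} {α : G ≃+ G} {g : G}
    (hf : ∀ x, f x = α x + g) : f ∈ assocSubgroup γ ↔ γ g = α := by
  constructor
  · intro hmem
    obtain ⟨k, rfl⟩ := hγ.mem_assocSubgroup_iff.1 hmem
    obtain rfl : k = g := by simpa [nu_apply] using hf 0
    exact AddEquiv.ext fun x => add_right_cancel (hf x)
  · rintro rfl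
    exact hγ.mem_assocSubgroup_iff.2 ⟨g, Equiv.ext fun x => (hf x).symm⟩

theorem assocSubgroup_eq_iff (hγ : IsGammaFunction γ) :
    assocSubgroup γ' = assocSubgroup γ ↔ γ' = γ := by
  refine ⟨fun h => funext fun g => ?_, fun h => h ▸ rfl⟩
  exact ((hγ.mem_assocSubgroup_iff_of_apply (nu_apply γ' g)).1 (h ▸ nu_mem_assocSubgroup γ' g)).symm

theorem map_zero (hγ : IsGammaFunction γ) : γ 0 = AddEquiv.refl G :=
  ((hγ.mem_assocSubgroup_iff_of_apply fun x => (add_zero x).symm).1 (one_mem _))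

theorem isRegularSubgroup (hγ : IsGammaFunction γ) : IsRegularSubgroup (assocSubgroup γ) := by
  have free : ∀ f ∈ assocSubgroup γ, f 0 = 0 → f = 1 := fun f hf h0 => by
    obtain ⟨g, rfl⟩ := hγ.mem_assocSubgroup_iff.1 hf
    obtain rfl : g = 0 := by simpa [nu_apply] using h0
    ext x
    rw [nu_apply, hγ.map_zero, add_zero]
    rfl
  have apply_zero (g : G) : nu γ g 0 = g := by rw [nu_apply, _root_.map_zero, zero_add]
  intro x y
  refine ⟨nu γ y * (nu γ x)⁻¹,
    ⟨mul_mem (nu_mem_assocSubgroup γ y) (inv_mem (nu_mem_assocSubgroup γ x)), ?_⟩, ?_⟩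
  · rw [Perm.mul_apply, Perm.inv_eq_iff_eq.2 (apply_zero x).symm, apply_zero]
  · rintro f ⟨hf, hfx⟩
    have h1 : (nu γ y)⁻¹ * (f * nu γ x) = 1 := by
      refine free _ (mul_mem (inv_mem (nu_mem_assocSubgroup γ y))
        (mul_mem hf (nu_mem_assocSubgroup γ x))) ?_
      rw [Perm.mul_apply, Perm.mul_apply, apply_zero, hfx, Perm.inv_eq_iff_eq, apply_zero]
    exact eq_mul_inv_of_mul_eq (inv_mul_eq_one.1 h1).symm

theorem assocSubgroup_le_normalizer_iff (hγ : IsGammaFunction γ) (hγ' : IsGammaFunction γ') :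
    assocSubgroup γ' ≤ Subgroup.normalizer (assocSubgroup γ : Set (Perm G)) ↔
      ∀ g h, γ (-(γ' h).symm.trans ((γ g).trans (γ' h)) h + γ' h g + h) =
        (γ' h).symm.trans ((γ g).trans (γ' h)) := by
  simp only [Subgroup.le_normalizer_iff, hγ.mem_assocSubgroup_iff (γ := γ),
    hγ'.mem_assocSubgroup_iff (γ := γ'), forall_exists_index, forall_apply_eq_imp_iff]
  simp only [← hγ.mem_assocSubgroup_iff, hγ.mem_assocSubgroup_iff_of_apply (conj_nu_apply γ γ' _ _)]
  exact forall_comm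

end IsGammaFunction

theorem exists_isGammaFunction_of_mem_regularSubgroups {N : Subgroup (Perm G)}
    (hN : N ∈ regularSubgroups G) : ∃ γ, IsGammaFunction γ ∧ N = assocSubgroup γ := by
  obtain ⟨hle, hreg⟩ := hN
  have exists_nu : ∀ g, ∃ α : G ≃+ G, ∃ f ∈ N, ∀ x, f x = α x + g := fun g => by
    obtain ⟨f, ⟨hf, h0⟩, -⟩ := hreg 0 g
    obtain ⟨α, g', h⟩ := mem_hol_iff.1 (hle hf)
    obtain rfl : g' = g := by simpa [h0] using (h 0).symm
    exact ⟨α, f, hf, h⟩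
  choose γ f hf hfγ using exists_nu
  have nu_mem (g : G) : nu γ g ∈ N := by
    rw [show nu γ g = f g from Equiv.ext fun x => (hfγ g x).symm]
    exact hf g
  have eq_nu {p : Perm G} (hp : p ∈ N) : p = nu γ (p 0) :=
    (hreg 0 (p 0)).unique ⟨hp, rfl⟩ ⟨nu_mem _, by rw [nu_apply, map_zero, zero_add]⟩
  have hγ : IsGammaFunction γ := fun g h => AddEquiv.ext fun x => by
    have hmul := DFunLike.congr_fun (eq_nu (mul_mem (nu_mem h) (nu_mem g))) x
    simpa [nu_apply, add_assoc] using hmul.symm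
  refine ⟨γ, hγ, Subgroup.ext fun p => ⟨fun hp => ?_, fun hp => ?_⟩⟩
  · exact hγ.mem_assocSubgroup_iff.2 ⟨p 0, (eq_nu hp).symm⟩
  · obtain ⟨g, rfl⟩ := hγ.mem_assocSubgroup_iff.1 hp
    exact nu_mem g

theorem mem_regularSubgroups_iff_exists_isGammaFunction {N : Subgroup (Perm G)} :
    N ∈ regularSubgroups G ↔ ∃ γ, IsGammaFunction γ ∧ N = assocSubgroup γ := by
  refine ⟨exists_isGammaFunction_of_mem_regularSubgroups, ?_⟩
  rintro ⟨γ, hγ, rfl⟩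
  exact ⟨assocSubgroup_le_hol γ, hγ.isRegularSubgroup⟩

end GammaFunction

section CyclicTwoGroup

variable {n : ℕ}

theorem two_pow_self_eq_zero (n : ℕ) : (2 : C n) ^ n = 0 := by
  exact_mod_cast ZMod.natCast_self (2 ^ n)

theorem two_pow_mul_natCast_eq_iff (j k h : ℕ) :
    (2 : C n) ^ j * k = 2 ^ j * h ↔ k ≡ h [MOD 2 ^ (n - j)] := by
  have cast_iff : (2 : C n) ^ j * k = 2 ^ j * h ↔ 2 ^ j * k ≡ 2 ^ j * h [MOD 2 ^ n] := by
    rw [← ZMod.natCast_eq_natCast_iff]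
    push_cast
    rfl
  rw [cast_iff]
  rcases le_total j n with hj | hj
  · obtain ⟨i, rfl⟩ := Nat.exists_eq_add_of_le hj
    rw [pow_add, Nat.ModEq.mul_left_cancel_iff' (by positivity), Nat.add_sub_cancel_left]
  · rw [Nat.sub_eq_zero_of_le hj, pow_zero]
    have two_pow_mul_modEq_zero (i : ℕ) : 2 ^ j * i ≡ 0 [MOD 2 ^ n] :=
      Nat.modEq_zero_iff_dvd.2 ((pow_dvd_pow 2 hj).mul_right i)
    exact iff_of_true ((two_pow_mul_modEq_zero k).trans (two_pow_mul_modEq_zero h).symm)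
      Nat.modEq_one

theorem two_pow_ne_zero {j : ℕ} (hj : j < n) : (2 : C n) ^ j ≠ 0 := by
  intro h
  have hmod := (two_pow_mul_natCast_eq_iff (n := n) j 1 0).1 (by simp [h])
  have hone : 2 ^ (n - j) = 1 := Nat.dvd_one.1 (Nat.modEq_zero_iff_dvd.1 hmod)
  exact (Nat.one_lt_two_pow (Nat.sub_ne_zero_of_lt hj)).ne' hone

theorem exists_eq_of_two_pow_mul_eq_zero {j : ℕ} {x : C n} (h : 2 ^ j * x = 0) :
    ∃ y, x = 2 ^ (n - j) * y := by
  obtain ⟨k, rfl⟩ := ZMod.natCast_zmod_surjective x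
  have hmod := (two_pow_mul_natCast_eq_iff (n := n) j k 0).1 (by simpa using h)
  obtain ⟨y, rfl⟩ := Nat.modEq_zero_iff_dvd.1 hmod
  exact ⟨y, by push_cast; rfl⟩

theorem even_or_odd (x : C n) : (∃ y, x = 2 * y) ∨ ∃ y, x = 2 * y + 1 := by
  obtain ⟨k, rfl⟩ := ZMod.natCast_zmod_surjective x
  rcases Nat.even_or_odd' k with ⟨j, rfl | rfl⟩
  · exact .inl ⟨j, by push_cast; rfl⟩
  · exact .inr ⟨j, by push_cast; rfl⟩

theorem isUnit_two_mul_add_one (t : C n) : IsUnit (2 * t + 1) :=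
  IsNilpotent.isUnit_add_one ⟨n, by rw [mul_pow, two_pow_self_eq_zero, zero_mul]⟩

theorem eq_zero_of_mul_odd {x : C n} (t : C n) (h : x * (2 * t + 1) = 0) : x = 0 :=
  (isUnit_two_mul_add_one t).mul_left_eq_zero.1 h

theorem exists_mul_eq_of_isUnit {a : C n} (ha : IsUnit a) (x : C n) : ∃ y, a * y = x := by
  obtain ⟨u, rfl⟩ := ha
  exact ⟨↑u⁻¹ * x, u.mul_inv_cancel_left x⟩

theorem exists_eq_two_mul_add_one_of_isUnit {x : C n} (hx : IsUnit x) :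
    ∃ y, x = 2 * y + 1 := by
  obtain rfl | hn := Nat.eq_zero_or_pos n
  · exact ⟨0, Subsingleton.elim (α := ZMod 1) _ _⟩
  obtain ⟨k, rfl⟩ := ZMod.natCast_zmod_surjective x
  rw [ZMod.isUnit_iff_coprime, Nat.coprime_pow_right_iff hn, Nat.coprime_two_right] at hx
  obtain ⟨j, rfl⟩ := hx
  exact ⟨j, by push_cast; rfl⟩

/-- The element `q = 2 ^ (n - 4)`, a sixteenth of the modulus when `4 ≤ n`. The constants
`2 ^ (n - 2)` and `2 ^ (n - 1)` are written `4 * q` and `8 * q`, which turns all identities between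
them into consequences of `16 * q = 0`. -/
def sixteenth (n : ℕ) : C n := 2 ^ (n - 4)

theorem sixteen_mul_sixteenth (n : ℕ) : 16 * sixteenth n = 0 := by
  rw [sixteenth, show (16 : C n) = 2 ^ 4 by norm_num, ← pow_add]
  exact pow_eq_zero_of_le (by omega) (two_pow_self_eq_zero n)

theorem two_pow_sub_two (hn : 4 ≤ n) : (2 : C n) ^ (n - 2) = 4 * sixteenth n := by
  rw [sixteenth, show n - 2 = (n - 4) + 2 by omega, pow_add]
  ring

theorem two_pow_sub_one (hn : 4 ≤ n) : (2 : C n) ^ (n - 1) = 8 * sixteenth n := by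
  rw [sixteenth, show n - 1 = (n - 4) + 3 by omega, pow_add]
  ring

theorem eight_mul_sixteenth_ne_zero (hn : 4 ≤ n) : 8 * sixteenth n ≠ 0 := by
  rw [← two_pow_sub_one hn]
  exact two_pow_ne_zero (by omega)

theorem eight_ne_zero (hn : 4 ≤ n) : (8 : C n) ≠ 0 :=
  left_ne_zero_of_mul (eight_mul_sixteenth_ne_zero hn)

theorem exists_eq_of_two_mul_eq_zero (hn : 4 ≤ n) {x : C n} (h : 2 * x = 0) :
    ∃ y, x = 8 * sixteenth n * y := by
  rw [← two_pow_sub_one hn]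
  exact exists_eq_of_two_pow_mul_eq_zero (j := 1) (by rwa [pow_one])

theorem exists_eq_of_four_mul_eq_zero (hn : 4 ≤ n) {x : C n} (h : 4 * x = 0) :
    ∃ y, x = 4 * sixteenth n * y := by
  rw [← two_pow_sub_two hn]
  exact exists_eq_of_two_pow_mul_eq_zero (j := 2) (by linear_combination h)

/-- The residue of `x` modulo `2`, as the element `0` or `1` of `C n`. -/
def parity (x : C n) : C n := ((x.val % 2 : ℕ) : C n)

theorem val_natCast_mod_of_dvd {m : ℕ} (hm : m ∣ 2 ^ n) (k : ℕ) : (k : C n).val % m = k % m := by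
  rw [ZMod.val_natCast, Nat.mod_mod_of_dvd _ hm]

theorem parity_natCast (k : ℕ) : parity (k : C n) = ((k % 2 : ℕ) : C n) := by
  obtain rfl | hn := Nat.eq_zero_or_pos n
  · exact Subsingleton.elim (α := ZMod 1) _ _
  · rw [parity, val_natCast_mod_of_dvd (dvd_pow_self 2 hn.ne')]

theorem parity_one : parity (1 : C n) = 1 := by
  simpa using parity_natCast (n := n) 1

theorem parity_two_mul (x : C n) : parity (2 * x) = 0 := by
  obtain ⟨k, rfl⟩ := ZMod.natCast_zmod_surjective x
  simpa using parity_natCast (n := n) (2 * k)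

theorem parity_add (x y : C n) :
    parity (x + y) = parity x + parity y - 2 * parity x * parity y := by
  obtain ⟨k, rfl⟩ := ZMod.natCast_zmod_surjective x
  obtain ⟨l, rfl⟩ := ZMod.natCast_zmod_surjective y
  rw [← Nat.cast_add, parity_natCast, parity_natCast, parity_natCast, Nat.add_mod]
  rcases Nat.mod_two_eq_zero_or_one k with hk | hk <;>
    rcases Nat.mod_two_eq_zero_or_one l with hl | hl <;>
    norm_num [hk, hl]

theorem exists_eq_parity_add_two_mul (x : C n) : ∃ y, x = parity x + 2 * y := by
  obtain ⟨k, rfl⟩ := ZMod.natCast_zmod_surjective x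
  refine ⟨(k / 2 : ℕ), ?_⟩
  rw [parity_natCast]
  exact_mod_cast congrArg (Nat.cast : ℕ → C n) (Nat.mod_add_div k 2).symm

theorem pow_val_eq_of_sq_eq_one {a : C n} (ha : a ^ 2 = 1) (x : C n) :
    a ^ x.val = 1 + (a - 1) * parity x := by
  rw [pow_eq_pow_mod _ ha, parity]
  rcases Nat.mod_two_eq_zero_or_one x.val with h | h <;> simp [h]

theorem addEquiv_apply_eq_mul (α : C n ≃+ C n) (x : C n) : α x = α 1 * x := by
  obtain ⟨k, rfl⟩ := ZMod.natCast_zmod_surjective x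
  simpa [mul_comm] using map_nsmul α k 1

theorem isUnit_addEquiv_one (α : C n ≃+ C n) : IsUnit (α 1) :=
  .of_mul_eq_one (α.symm 1) (by rw [← addEquiv_apply_eq_mul, α.apply_symm_apply])

theorem sigma_addEquiv_one (α : C n ≃+ C n) : sigma (α 1) = α :=
  AddEquiv.ext fun x => by
    rw [sigma_apply (isUnit_addEquiv_one α), ← addEquiv_apply_eq_mul]

theorem addEquiv_trans_trans_symm (α β : C n ≃+ C n) : α.trans (β.trans α.symm) = β :=
  AddEquiv.ext fun x => by
    rw [AddEquiv.trans_apply, AddEquiv.trans_apply, AddEquiv.symm_apply_eq,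
      addEquiv_apply_eq_mul β, addEquiv_apply_eq_mul α x, addEquiv_apply_eq_mul α (β x),
      addEquiv_apply_eq_mul β x, mul_left_comm]

theorem sigma_eq_sigma_iff {a b : C n} (ha : IsUnit a) (hb : IsUnit b) :
    sigma a = sigma b ↔ a = b := by
  refine ⟨fun h => ?_, congrArg sigma⟩
  simpa [sigma_apply ha, sigma_apply hb] using DFunLike.congr_fun h 1

end CyclicTwoGroup

section Multiplier

variable {n : ℕ} {c c' : C n → C n}

/-- A unit-valued function `c` on `C n` for which `x ↦ σ_{c x}` is a gamma function; every gamma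
function on `C n` has this form. -/
structure IsMultiplier (c : C n → C n) : Prop where
  isUnit : ∀ x, IsUnit (c x)
  map_circ : ∀ g h, c (c h * g + h) = c g * c h

/-- The subgroup of `Sym(C n)` associated with `x ↦ σ_{c x}`. -/
noncomputable def affineGroup (c : C n → C n) : Subgroup (Perm (C n)) :=
  assocSubgroup fun x => sigma (c x)

namespace IsMultiplier

theorem isGammaFunction (hc : IsMultiplier c) : IsGammaFunction fun x => sigma (c x) := by
  intro g h
  ext x
  rw [AddEquiv.trans_apply, sigma_apply (hc.isUnit h), sigma_apply (hc.isUnit g),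
    sigma_apply (hc.isUnit h), sigma_apply (hc.isUnit _), hc.map_circ]
  ring

theorem affineGroup_eq_iff (hc : IsMultiplier c) (hc' : IsMultiplier c') :
    affineGroup c = affineGroup c' ↔ c = c' := by
  rw [affineGroup, affineGroup, hc'.isGammaFunction.assocSubgroup_eq_iff]
  simp only [funext_iff, sigma_eq_sigma_iff (hc.isUnit _) (hc'.isUnit _)]

theorem map_zero (hc : IsMultiplier c) : c 0 = 1 := by
  have h := hc.map_circ 0 0
  rw [mul_zero, add_zero] at h
  exact (hc.isUnit 0).mul_left_cancel (by rw [← h, mul_one])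

theorem comp_mul (hc : IsMultiplier c) (s : C n) : IsMultiplier fun x => c (s * x) where
  isUnit _ := hc.isUnit _
  map_circ g h := by
    rw [← hc.map_circ]
    congr 1
    ring

theorem map_add_of_map_eq_one (hc : IsMultiplier c) {k : C n} (hk : c k = 1) (g : C n) :
    c (g + k) = c g := by
  simpa [hk] using hc.map_circ g k

theorem map_mul_of_map_eq_one (hc : IsMultiplier c) {k : C n} (hk : c k = 1) (x : C n) :
    c (x * k) = 1 := by
  obtain ⟨j, rfl⟩ := ZMod.natCast_zmod_surjective x
  induction j with
  | zero => rw [Nat.cast_zero, zero_mul, hc.map_zero]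
  | succ j ih => rw [Nat.cast_succ, add_mul, one_mul, hc.map_add_of_map_eq_one hk, ih]

theorem map_eq_iff (hc : IsMultiplier c) {g h : C n} : c g = c h ↔ c (g - h) = 1 := by
  refine ⟨fun heq => ?_, fun hone => ?_⟩
  · obtain ⟨k, hk⟩ := exists_mul_eq_of_isUnit (hc.isUnit h) (g - h)
    have hmul := hc.map_circ k h
    rw [hk, sub_add_cancel, heq, eq_comm, (hc.isUnit h).mul_eq_right] at hmul
    rw [← hk]
    exact hc.map_mul_of_map_eq_one hmul (c h)
  · simpa using hc.map_add_of_map_eq_one hone h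

theorem affineGroup_le_normalizer_iff (hc : IsMultiplier c) (hc' : IsMultiplier c') :
    affineGroup c' ≤ Subgroup.normalizer (affineGroup c : Set (Perm (C n))) ↔
      ∀ g h, c ((c' h - 1) * g - (c g - 1) * h) = 1 := by
  have conj_eq (α β : C n ≃+ C n) : α.symm.trans (β.trans α) = β :=
    addEquiv_trans_trans_symm α.symm β
  rw [affineGroup, affineGroup,
    hc.isGammaFunction.assocSubgroup_le_normalizer_iff hc'.isGammaFunction]
  simp only [conj_eq, sigma_eq_sigma_iff (hc.isUnit _) (hc.isUnit _), sigma_apply (hc.isUnit _),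
    sigma_apply (hc'.isUnit _), hc.map_eq_iff]
  refine forall₂_congr fun g h => ?_
  ring_nf

end IsMultiplier

theorem mem_regularSubgroups_iff_exists_isMultiplier {N : Subgroup (Perm (C n))} :
    N ∈ regularSubgroups (C n) ↔ ∃ c, IsMultiplier c ∧ N = affineGroup c := by
  rw [mem_regularSubgroups_iff_exists_isGammaFunction]
  constructor
  · rintro ⟨γ, hγ, rfl⟩
    refine ⟨fun x => γ x 1, ⟨fun x => isUnit_addEquiv_one (γ x), fun g h => ?_⟩, ?_⟩
    · rw [← addEquiv_apply_eq_mul, hγ, AddEquiv.trans_apply, addEquiv_apply_eq_mul, mul_comm]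
    · simp only [affineGroup, sigma_addEquiv_one]
  · rintro ⟨c, hc, rfl⟩
    exact ⟨_, hc.isGammaFunction, rfl⟩

theorem conjK_affineGroup (c : C n → C n) (k : ℕ) :
    conjK (affineGroup c) k = affineGroup fun x => c ((2 * k + 1) * x) := by
  rw [conjK, affineGroup, conjSubgroup_assocSubgroup]
  simp only [AddEquiv.symm_symm, addEquiv_trans_trans_symm,
    sigma_apply (isUnit_two_mul_add_one _), affineGroup]

end Multiplier

section TwoParameterFamily

variable {n : ℕ} {w b w' b' : C n}

/-- The function `x ↦ 1 + 2 b x`, shifted by `2 w` at the odd `x`. Every multiplier on `C n` has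
this form, and `isMultiplier_multiplier_iff` says for which parameters it is one. -/
def multiplier (w b x : C n) : C n := 1 + 2 * b * x + 2 * w * parity x

theorem isUnit_multiplier (w b x : C n) : IsUnit (multiplier w b x) := by
  convert isUnit_two_mul_add_one (b * x + w * parity x) using 1
  rw [multiplier]
  ring

theorem multiplier_one (w b : C n) : multiplier w b 1 = 1 + 2 * b + 2 * w := by
  rw [multiplier, parity_one, mul_one, mul_one]

theorem multiplier_two_mul (w b x : C n) : multiplier w b (2 * x) = 1 + 4 * b * x := by
  rw [multiplier, parity_two_mul]
  ring

theorem multiplier_two_mul_add_one (w b x : C n) :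
    multiplier w b (2 * x + 1) = 1 + 4 * b * x + 2 * b + 2 * w := by
  rw [multiplier, parity_add, parity_two_mul, parity_one]
  ring

theorem multiplier_eq_iff :
    multiplier w b = multiplier w' b' ↔ 4 * (b - b') = 0 ∧ 2 * (b + w) = 2 * (b' + w') := by
  constructor
  · intro h
    have h1 := congrFun h 1
    have h2 := congrFun h (2 * 1)
    rw [multiplier_one, multiplier_one] at h1
    rw [multiplier_two_mul, multiplier_two_mul] at h2
    exact ⟨by linear_combination h2, by linear_combination h1⟩
  · rintro ⟨h1, h2⟩
    funext x
    obtain ⟨y, hy⟩ := exists_eq_parity_add_two_mul x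
    rw [multiplier, multiplier]
    linear_combination 2 * (b - b') * hy + y * h1 + parity x * h2

theorem multiplier_circ (w b g h : C n) :
    multiplier w b (multiplier w b h * g + h) =
      multiplier w b g * multiplier w b h - 4 * w * parity g * ((1 + w) * parity h + b * h) := by
  have parity_circ :
      parity (multiplier w b h * g + h) = parity g + parity h - 2 * parity g * parity h := by
    rw [show multiplier w b h * g + h = 2 * ((b * h + w * parity h) * g) + (g + h) by
      rw [multiplier]; ring, parity_add, parity_two_mul, parity_add]
    ring
  rw [multiplier, parity_circ, multiplier, multiplier]
  ring

theorem isMultiplier_multiplier_iff :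
    IsMultiplier (multiplier w b) ↔ 8 * (b * w) = 0 ∧ 4 * (w * (w + b + 1)) = 0 := by
  constructor
  · intro hc
    have h1 := hc.map_circ 1 (2 * 1)
    have h2 := hc.map_circ 1 1
    rw [multiplier_circ, sub_eq_self, parity_one] at h1 h2
    rw [parity_two_mul] at h1
    exact ⟨by linear_combination h1, by linear_combination h2⟩
  · rintro ⟨h1, h2⟩
    refine ⟨isUnit_multiplier w b, fun g h => ?_⟩
    obtain ⟨y, hy⟩ := exists_eq_parity_add_two_mul h
    rw [multiplier_circ, sub_eq_self]
    linear_combination 4 * w * parity g * b * hy + parity g * y * h1 + parity g * parity h * h2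

theorem affineGroup_multiplier_le_normalizer_iff (hc : IsMultiplier (multiplier w b))
    (hc' : IsMultiplier (multiplier w' b')) :
    affineGroup (multiplier w' b') ≤
        Subgroup.normalizer (affineGroup (multiplier w b) : Set (Perm (C n))) ↔
      8 * (b * w') = 0 ∧ 4 * (b * (b' + w' - (b + w))) = 0 := by
  have map_eq_one_iff (g h : C n) :
      multiplier w b ((multiplier w' b' h - 1) * g - (multiplier w b g - 1) * h) = 1 ↔
        4 * b * ((b' - b) * g * h + w' * parity h * g - w * parity g * h) = 0 := by
    rw [show (multiplier w' b' h - 1) * g - (multiplier w b g - 1) * h =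
      2 * ((b' - b) * g * h + w' * parity h * g - w * parity g * h) by
        rw [multiplier, multiplier]; ring, multiplier_two_mul, add_eq_left]
  rw [hc.affineGroup_le_normalizer_iff hc']
  simp only [map_eq_one_iff]
  constructor
  · intro H
    have h11 := H 1 1
    have h12 := H 1 (2 * 1)
    have h21 := H (2 * 1) 1
    rw [parity_one] at h11 h12 h21
    rw [parity_two_mul] at h12 h21
    exact ⟨by linear_combination 2 * h11 - h12, by linear_combination h11⟩
  · rintro ⟨h1, h2⟩ g h
    have h3 := (isMultiplier_multiplier_iff.1 hc).1
    obtain ⟨x, hx⟩ := exists_eq_parity_add_two_mul g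
    obtain ⟨y, hy⟩ := exists_eq_parity_add_two_mul h
    generalize parity g = p at *
    generalize parity h = r at *
    subst hx hy
    linear_combination (p * r + 2 * (p * y + x * r + 2 * x * y)) * h2
      + (x * r - (p * y + x * r + 2 * x * y)) * h1 + (x * r + 2 * x * y) * h3

end TwoParameterFamily

section Classification

variable {n : ℕ} {c : C n → C n} {d s p : C n} {S : Set (C n)}

theorem exists_two_pow_mul_odd_mem (one_mem : 1 ∈ S)
    (circ_mem : ∀ x ∈ S, ∀ y ∈ S, (1 + 4 * d * y) * x + y ∈ S) (j : ℕ) :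
    ∃ e, 2 ^ j * (2 * e + 1) ∈ S := by
  induction j with
  | zero => exact ⟨0, by simpa using one_mem⟩
  | succ j ih =>
    obtain ⟨e, he⟩ := ih
    refine ⟨e + d * (2 ^ j * (2 * e + 1)) * (2 * e + 1), ?_⟩
    convert circ_mem _ he _ he using 1
    ring

theorem mem_of_one_mem_of_circ_mem (one_mem : 1 ∈ S)
    (circ_mem : ∀ x ∈ S, ∀ y ∈ S, (1 + 4 * d * y) * x + y ∈ S) (x : C n) : x ∈ S := by
  suffices multiples_mem : ∀ z : C n, 2 ^ 0 * z ∈ S by simpa using multiples_mem x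
  refine Nat.decreasingInduction' (P := fun j => ∀ z : C n, 2 ^ j * z ∈ S)
    (fun j _ _ ih z => ?_) n.zero_le fun z => ?_
  · rcases even_or_odd z with ⟨y, rfl⟩ | ⟨y, rfl⟩
    · rw [← mul_assoc, ← pow_succ]
      exact ih y
    · -- choose `s = 2 ^ j * odd ∈ S`; an odd multiple `z` of `2 ^ j` is `(1 + 4 d s) t + s`, where
      -- `t = (1 + 4 d s)⁻¹ (z - s)` is a multiple of `2 ^ (j + 1)`
      obtain ⟨e, he⟩ := exists_two_pow_mul_odd_mem one_mem circ_mem j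
      obtain ⟨t, ht⟩ := exists_mul_eq_of_isUnit
        (isUnit_two_mul_add_one (2 * d * (2 ^ j * (2 * e + 1)))) (y - e)
      convert circ_mem _ (ih t) _ he using 1
      linear_combination (-2 ^ (j + 1)) * ht
  · obtain ⟨e, he⟩ := exists_two_pow_mul_odd_mem one_mem circ_mem n
    rw [two_pow_self_eq_zero, zero_mul] at he ⊢
    exact he

namespace IsMultiplier

theorem eq_of_map_one (hc : IsMultiplier c) (h1 : c 1 = 1 + 4 * d) (x : C n) :
    c x = 1 + 4 * d * x := by
  refine mem_of_one_mem_of_circ_mem (d := d) (S := {x | c x = 1 + 4 * d * x})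
    (by simpa using h1) (fun x hx y hy => ?_) x
  have hmul := hc.map_circ x y
  rw [hx, hy] at hmul
  rw [Set.mem_ofPred_eq, hmul]
  ring

theorem isCyclic_affineGroup (hc : IsMultiplier c) (h1 : c 1 = 1 + 4 * d) :
    IsCyclic (affineGroup c) := by
  have mem_iff {f : Perm (C n)} : f ∈ affineGroup c ↔ ∃ g, nu (fun x => sigma (c x)) g = f :=
    hc.isGammaFunction.mem_assocSubgroup_iff
  have nu_eq (g x : C n) : nu (fun x => sigma (c x)) g x = (1 + 4 * d * g) * x + g := by
    rw [nu_apply, sigma_apply (hc.isUnit g), hc.eq_of_map_one h1]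
  let f : affineGroup c := ⟨_, mem_iff.2 ⟨1, rfl⟩⟩
  have exists_pow_eq (g : C n) : ∃ k : ℕ, ((f ^ k : affineGroup c) : Perm (C n)) =
      nu (fun x => sigma (c x)) g := by
    refine mem_of_one_mem_of_circ_mem (d := d) (S := {g | ∃ k : ℕ,
      ((f ^ k : affineGroup c) : Perm (C n)) = nu (fun x => sigma (c x)) g})
      ⟨1, by rw [pow_one]⟩ ?_ g
    rintro g ⟨k, hk⟩ h ⟨l, hl⟩
    refine ⟨l + k, ?_⟩
    ext x
    rw [pow_add, Subgroup.coe_mul, hk, hl, Perm.mul_apply, nu_eq, nu_eq, nu_eq]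
    ring
  refine ⟨f, fun ⟨p, hp⟩ => ?_⟩
  obtain ⟨g, rfl⟩ := mem_iff.1 hp
  obtain ⟨k, hk⟩ := exists_pow_eq g
  exact ⟨k, Subtype.ext ((congrArg Subtype.val (zpow_natCast f k)).trans hk)⟩

theorem exists_map_two_eq (hc : IsMultiplier c) (h1 : c 1 = 4 * s + 3) :
    ∃ p, c 2 = 1 + 4 * p := by
  obtain ⟨b, hb⟩ := exists_eq_two_mul_add_one_of_isUnit (hc.isUnit 2)
  rcases even_or_odd b with ⟨p, rfl⟩ | ⟨p, rfl⟩
  · exact ⟨p, by rw [hb]; ring⟩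
  -- if also `c 2 = 4 * p + 3`, then `c 1 * 2 + 1` and `c 2 * 1 + 2`, at which `c` takes the same
  -- value, differ by `2 * odd`, which forces `c 2 = 1`
  have hcomm : c (c 1 * 2 + 1) = c (c 2 * 1 + 2) := by
    rw [hc.map_circ, hc.map_circ, mul_comm]
  rw [hc.map_eq_iff, h1, hb] at hcomm
  obtain ⟨y, hy⟩ := exists_mul_eq_of_isUnit (isUnit_two_mul_add_one (2 * s - p)) (1 : C n)
  have hone := hc.map_mul_of_map_eq_one hcomm y
  rw [show y * ((4 * s + 3) * 2 + 1 - ((2 * (2 * p + 1) + 1) * 1 + 2)) = 2 by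
    linear_combination 2 * hy] at hone
  exact ⟨0, by rw [hone]; ring⟩

theorem eq_multiplier (hc : IsMultiplier c) (h1 : c 1 = 4 * s + 3) (h2 : c 2 = 1 + 4 * p) :
    c = multiplier (2 * s + 1 - p) p := by
  have map_two_mul (y : C n) : c (2 * y) = 1 + 4 * p * y :=
    (hc.comp_mul 2).eq_of_map_one (by rw [mul_one, h2]) y
  funext x
  rcases even_or_odd x with ⟨y, rfl⟩ | ⟨y, rfl⟩
  · rw [map_two_mul, multiplier_two_mul]
  · obtain ⟨z, rfl⟩ := exists_mul_eq_of_isUnit (hc.isUnit 1) y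
    have hmul := hc.map_circ (2 * z) 1
    rw [map_two_mul, mul_left_comm] at hmul
    rw [hmul, multiplier_two_mul_add_one, h1]
    ring

end IsMultiplier

end Classification

section MultiplierFamilies

variable {n : ℕ}

/-- The multiplier `x ↦ 1 + 4 t x`; its group is cyclic and is one of the `N_{c,u}^k`. -/
def cyclicMultiplier (t : C n) : C n → C n := multiplier 0 (2 * t)

/-- The multipliers of the groups `N_p^k` (even `e`) and `N_m^k` (odd `e`). -/
def oddMultiplier (e t : C n) : C n → C n := multiplier (2 * sixteenth n * e) (2 * t + 1)

/-- The multipliers of `N₃`, `N₄`, `N₅`, `N₆`, at `(i, j) = (0, 1), (0, 0), (1, 1), (1, 0)`. Only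
the residues of `i` and `j` modulo `2` matter. -/
def exceptionalMultiplier (i j : C n) : C n → C n :=
  multiplier (4 * sixteenth n * j - 1 - 2 * sixteenth n * i) (2 * sixteenth n * i)

theorem isMultiplier_cyclic (t : C n) : IsMultiplier (cyclicMultiplier t) :=
  isMultiplier_multiplier_iff.2 ⟨by ring, by ring⟩

theorem isMultiplier_odd (e t : C n) : IsMultiplier (oddMultiplier e t) :=
  isMultiplier_multiplier_iff.2
    ⟨by linear_combination (2 * t + 1) * e * sixteen_mul_sixteenth n,
      by linear_combination (sixteenth n * e + t + 1) * e * sixteen_mul_sixteenth n⟩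

theorem isMultiplier_exceptional (i j : C n) : IsMultiplier (exceptionalMultiplier i j) :=
  isMultiplier_multiplier_iff.2
    ⟨by linear_combination i * (4 * sixteenth n * j - 1 - 2 * sixteenth n * i) *
        sixteen_mul_sixteenth n,
      by linear_combination j * (4 * sixteenth n * j - 1 - 2 * sixteenth n * i) *
        sixteen_mul_sixteenth n⟩

theorem cyclicMultiplier_eq_iff {t s : C n} :
    cyclicMultiplier t = cyclicMultiplier s ↔ 4 * t = 4 * s := by
  rw [cyclicMultiplier, cyclicMultiplier, multiplier_eq_iff]
  exact ⟨fun h => by linear_combination h.2,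
    fun h => ⟨by linear_combination 2 * h, by linear_combination h⟩⟩

theorem oddMultiplier_eq_iff {e t e' t' : C n} :
    oddMultiplier e t = oddMultiplier e' t' ↔
      8 * (t - t') = 0 ∧ 4 * (t + sixteenth n * e) = 4 * (t' + sixteenth n * e') := by
  rw [oddMultiplier, oddMultiplier, multiplier_eq_iff]
  exact ⟨fun h => ⟨by linear_combination h.1, by linear_combination h.2⟩,
    fun h => ⟨by linear_combination h.1, by linear_combination h.2⟩⟩

theorem oddMultiplier_right_inj {e t t' : C n} :
    oddMultiplier e t = oddMultiplier e t' ↔ 4 * t = 4 * t' := by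
  rw [oddMultiplier_eq_iff]
  exact ⟨fun h => by linear_combination h.2,
    fun h => ⟨by linear_combination 2 * h, by linear_combination h⟩⟩

theorem oddMultiplier_add_two_mul (e f t : C n) :
    oddMultiplier (e + 2 * f) t = oddMultiplier e (t + 2 * sixteenth n * f) :=
  oddMultiplier_eq_iff.2 ⟨by linear_combination (-f) * sixteen_mul_sixteenth n, by ring⟩

theorem exceptionalMultiplier_eq_iff {i j i' j' : C n} :
    exceptionalMultiplier i j = exceptionalMultiplier i' j' ↔
      8 * sixteenth n * i = 8 * sixteenth n * i' ∧
        8 * sixteenth n * j = 8 * sixteenth n * j' := by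
  rw [exceptionalMultiplier, exceptionalMultiplier, multiplier_eq_iff]
  exact ⟨fun h => ⟨by linear_combination h.1, by linear_combination h.2⟩,
    fun h => ⟨by linear_combination h.1, by linear_combination h.2⟩⟩

theorem two_mul_odd_ne_zero (hn : 4 ≤ n) (t : C n) : 2 * (2 * t + 1) ≠ 0 := fun h =>
  eight_ne_zero hn (by linear_combination 4 * eq_zero_of_mul_odd t h)

theorem cyclicMultiplier_ne_oddMultiplier (hn : 4 ≤ n) (s e t : C n) :
    cyclicMultiplier s ≠ oddMultiplier e t := by
  rw [Ne, cyclicMultiplier, oddMultiplier, multiplier_eq_iff]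
  exact fun h => two_mul_odd_ne_zero hn (t + sixteenth n * e - s) (by linear_combination -h.2)

theorem cyclicMultiplier_ne_exceptionalMultiplier (hn : 4 ≤ n) (s i j : C n) :
    cyclicMultiplier s ≠ exceptionalMultiplier i j := by
  rw [Ne, cyclicMultiplier, exceptionalMultiplier, multiplier_eq_iff]
  exact fun h => two_mul_odd_ne_zero hn (s - 2 * sixteenth n * j) (by linear_combination h.2)

theorem oddMultiplier_ne_exceptionalMultiplier (hn : 4 ≤ n) (e t i j : C n) :
    oddMultiplier e t ≠ exceptionalMultiplier i j := by
  rw [Ne, oddMultiplier, exceptionalMultiplier, multiplier_eq_iff]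
  refine fun h => eight_ne_zero hn ?_
  linear_combination 2 * eq_zero_of_mul_odd (t - sixteenth n * i) (x := (4 : C n))
    (by linear_combination h.1)

theorem IsMultiplier.eq_cyclic_or_odd_or_exceptional (hn : 4 ≤ n) {c : C n → C n}
    (hc : IsMultiplier c) :
    (∃ t, c = cyclicMultiplier t) ∨ (∃ e t, c = oddMultiplier e t) ∨
      ∃ i j, c = exceptionalMultiplier i j := by
  obtain ⟨y, h1⟩ := exists_eq_two_mul_add_one_of_isUnit (hc.isUnit 1)
  rcases even_or_odd y with ⟨t, rfl⟩ | ⟨s, rfl⟩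
  · refine .inl ⟨t, funext fun x => ?_⟩
    rw [hc.eq_of_map_one (d := t) (by rw [h1]; ring), cyclicMultiplier, multiplier]
    ring
  replace h1 : c 1 = 4 * s + 3 := by rw [h1]; ring
  obtain ⟨p, h2⟩ := hc.exists_map_two_eq h1
  obtain rfl := hc.eq_multiplier h1 h2
  obtain ⟨h8, h4⟩ := isMultiplier_multiplier_iff.1 hc
  rcases even_or_odd p with ⟨v, rfl⟩ | ⟨v, rfl⟩
  · have h8v : 2 * (8 * v) = 0 := eq_zero_of_mul_odd (s - v) (by linear_combination h8)
    have h8s : 2 * (4 * (s + 1)) = 0 := eq_zero_of_mul_odd (s - v) (by linear_combination h4)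
    obtain ⟨i, hi⟩ := exists_eq_of_two_mul_eq_zero hn h8v
    obtain ⟨j, hj⟩ := exists_eq_of_two_mul_eq_zero hn h8s
    refine .inr (.inr ⟨i, j, ?_⟩)
    rw [exceptionalMultiplier, multiplier_eq_iff]
    exact ⟨by linear_combination hi, by linear_combination hj⟩
  · have h16 : 4 * (4 * (s - v)) = 0 := eq_zero_of_mul_odd v (by linear_combination h8)
    obtain ⟨e, he⟩ := exists_eq_of_four_mul_eq_zero hn h16
    refine .inr (.inl ⟨e, v, ?_⟩)
    rw [oddMultiplier, multiplier_eq_iff]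
    exact ⟨by ring, by linear_combination he⟩

theorem mem_regularSubgroups_iff_cyclic_or_odd_or_exceptional (hn : 4 ≤ n)
    {N : Subgroup (Perm (C n))} :
    N ∈ regularSubgroups (C n) ↔
      (∃ t, N = affineGroup (cyclicMultiplier t)) ∨
        (∃ e t, N = affineGroup (oddMultiplier e t)) ∨
          ∃ i j, N = affineGroup (exceptionalMultiplier i j) := by
  rw [mem_regularSubgroups_iff_exists_isMultiplier]
  constructor
  · rintro ⟨c, hc, rfl⟩
    rcases hc.eq_cyclic_or_odd_or_exceptional hn with ⟨t, rfl⟩ | ⟨e, t, rfl⟩ | ⟨i, j, rfl⟩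
    · exact .inl ⟨t, rfl⟩
    · exact .inr (.inl ⟨e, t, rfl⟩)
    · exact .inr (.inr ⟨i, j, rfl⟩)
  · rintro (⟨t, rfl⟩ | ⟨e, t, rfl⟩ | ⟨i, j, rfl⟩)
    · exact ⟨_, isMultiplier_cyclic t, rfl⟩
    · exact ⟨_, isMultiplier_odd e t, rfl⟩
    · exact ⟨_, isMultiplier_exceptional i j, rfl⟩

end MultiplierFamilies

section ListedGammaFunctions

variable {n : ℕ}

theorem gamma1_eq (n : ℕ) : gamma1 n = fun x => sigma (cyclicMultiplier 0 x) := by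
  funext x
  rw [gamma1, cyclicMultiplier, multiplier]
  congr 1
  ring

theorem gamma2_eq (hn : 4 ≤ n) :
    gamma2 n = fun x => sigma (cyclicMultiplier (2 * sixteenth n) x) := by
  funext x
  obtain ⟨y, hy⟩ := exists_eq_parity_add_two_mul x
  rw [gamma2, two_pow_sub_one hn, pow_val_eq_of_sq_eq_one
    (by linear_combination (4 * sixteenth n + 1) * sixteen_mul_sixteenth n), cyclicMultiplier,
    multiplier]
  congr 1
  linear_combination (-8 * sixteenth n) * hy - y * sixteen_mul_sixteenth n

theorem gamma3_eq (hn : 4 ≤ n) : gamma3 n = fun x => sigma (exceptionalMultiplier 0 1 x) := by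
  funext x
  rw [gamma3, two_pow_sub_one hn, pow_val_eq_of_sq_eq_one
    (by linear_combination (4 * sixteenth n - 1) * sixteen_mul_sixteenth n),
    exceptionalMultiplier, multiplier]
  congr 1
  ring

theorem gamma4_eq (n : ℕ) : gamma4 n = fun x => sigma (exceptionalMultiplier 0 0 x) := by
  funext x
  rw [gamma4, two_pow_self_eq_zero, pow_val_eq_of_sq_eq_one (by ring), exceptionalMultiplier,
    multiplier]
  congr 1
  ring

theorem exceptionalMultiplier_one_left (j x : C n) :
    exceptionalMultiplier 1 j x = 1 + 4 * sixteenth n * (x.val % 4 : ℕ) +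
      (8 * sixteenth n * j - 2 - 4 * sixteenth n) * (x.val % 4 % 2 : ℕ) := by
  have hx : x = (x.val % 4 : ℕ) + 4 * (x.val / 4 : ℕ) := by
    conv_lhs => rw [← ZMod.natCast_zmod_val x, ← Nat.mod_add_div x.val 4, Nat.cast_add,
      Nat.cast_mul, Nat.cast_ofNat]
  rw [exceptionalMultiplier, multiplier, parity, Nat.mod_mod_of_dvd _ (by decide : 2 ∣ 4)]
  linear_combination 4 * sixteenth n * hx + (x.val / 4 : ℕ) * sixteen_mul_sixteenth n

theorem gamma5_eq (hn : 4 ≤ n) : gamma5 n = fun x => sigma (exceptionalMultiplier 1 1 x) := by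
  funext x
  rw [exceptionalMultiplier_one_left, gamma5, two_pow_sub_one hn, two_pow_self_eq_zero]
  have hlt : x.val % 4 < 4 := Nat.mod_lt _ (by decide)
  generalize x.val % 4 = r at hlt ⊢
  interval_cases r <;> simp only <;> congr 1 <;> push_cast
  · ring
  · ring
  · ring
  · linear_combination -sixteen_mul_sixteenth n

theorem gamma6_eq (hn : 4 ≤ n) : gamma6 n = fun x => sigma (exceptionalMultiplier 1 0 x) := by
  funext x
  rw [exceptionalMultiplier_one_left, gamma6, two_pow_sub_one hn, two_pow_self_eq_zero]
  have hlt : x.val % 4 < 4 := Nat.mod_lt _ (by decide)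
  generalize x.val % 4 = r at hlt ⊢
  interval_cases r <;> simp only <;> congr 1 <;> push_cast <;> ring

theorem gammaP_eq (n : ℕ) : gammaP n = fun x => sigma (oddMultiplier 0 0 x) := by
  funext x
  rw [gammaP, oddMultiplier, multiplier]
  congr 1
  ring

theorem gammaM_eq (hn : 4 ≤ n) : gammaM n = fun x => sigma (oddMultiplier 1 0 x) := by
  funext x
  rw [gammaM, two_pow_sub_two hn, oddMultiplier, multiplier, parity]
  rcases Nat.mod_two_eq_zero_or_one x.val with h | h <;> rw [h]
  · rw [if_pos rfl]
    congr 1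
    push_cast
    ring
  · rw [if_neg one_ne_zero]
    congr 1
    push_cast
    ring

theorem four_mul_two_pow_sub_two_mul {u : ℕ} (hu : 2 ≤ u) (x : C n) :
    4 * (2 ^ (u - 2) * x) = 2 ^ u * x := by
  obtain ⟨i, rfl⟩ := Nat.exists_eq_add_of_le' hu
  rw [Nat.add_sub_cancel, pow_add]
  ring

theorem gammaC_eq {u : ℕ} (hu : 2 ≤ u) :
    gammaC n u = fun x => sigma (cyclicMultiplier (2 ^ (u - 2)) x) := by
  funext x
  rw [gammaC, cyclicMultiplier, multiplier]
  congr 1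
  linear_combination -four_mul_two_pow_sub_two_mul hu x

theorem isGammaFunction_gamma (hn : 4 ≤ n) :
    IsGammaFunction (gamma1 n) ∧ IsGammaFunction (gamma2 n) ∧ IsGammaFunction (gamma3 n) ∧
      IsGammaFunction (gamma4 n) ∧ IsGammaFunction (gamma5 n) ∧ IsGammaFunction (gamma6 n) ∧
      IsGammaFunction (gammaP n) ∧ IsGammaFunction (gammaM n) ∧
      ∀ u, 2 ≤ u → u ≤ n → IsGammaFunction (gammaC n u) := by
  rw [gamma1_eq, gamma2_eq hn, gamma3_eq hn, gamma4_eq, gamma5_eq hn, gamma6_eq hn, gammaP_eq,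
    gammaM_eq hn]
  refine ⟨(isMultiplier_cyclic _).isGammaFunction, (isMultiplier_cyclic _).isGammaFunction,
    (isMultiplier_exceptional _ _).isGammaFunction, (isMultiplier_exceptional _ _).isGammaFunction,
    (isMultiplier_exceptional _ _).isGammaFunction, (isMultiplier_exceptional _ _).isGammaFunction,
    (isMultiplier_odd _ _).isGammaFunction, (isMultiplier_odd _ _).isGammaFunction,
    fun u hu _ => ?_⟩
  rw [gammaC_eq hu]
  exact (isMultiplier_cyclic _).isGammaFunction

end ListedGammaFunctions

section ListedGroups

variable {n : ℕ}

theorem N1_eq (n : ℕ) : N1 n = affineGroup (cyclicMultiplier 0) :=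
  congrArg assocSubgroup (gamma1_eq n)

theorem N2_eq (hn : 4 ≤ n) : N2 n = affineGroup (cyclicMultiplier (2 * sixteenth n)) :=
  congrArg assocSubgroup (gamma2_eq hn)

theorem N3_eq (hn : 4 ≤ n) : N3 n = affineGroup (exceptionalMultiplier 0 1) :=
  congrArg assocSubgroup (gamma3_eq hn)

theorem N4_eq (n : ℕ) : N4 n = affineGroup (exceptionalMultiplier 0 0) :=
  congrArg assocSubgroup (gamma4_eq n)

theorem N5_eq (hn : 4 ≤ n) : N5 n = affineGroup (exceptionalMultiplier 1 1) :=
  congrArg assocSubgroup (gamma5_eq hn)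

theorem N6_eq (hn : 4 ≤ n) : N6 n = affineGroup (exceptionalMultiplier 1 0) :=
  congrArg assocSubgroup (gamma6_eq hn)

theorem parity_odd_mul (k x : C n) : parity ((2 * k + 1) * x) = parity x := by
  rw [show (2 * k + 1) * x = 2 * (k * x) + x by ring, parity_add, parity_two_mul]
  ring

theorem multiplier_odd_mul (w b k x : C n) :
    multiplier w b ((2 * k + 1) * x) = multiplier w (b * (2 * k + 1)) x := by
  rw [multiplier, multiplier, parity_odd_mul]
  ring

theorem conjK_affineGroup_multiplier (w b : C n) (k : ℕ) :
    conjK (affineGroup (multiplier w b)) k = affineGroup (multiplier w (b * (2 * k + 1))) := by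
  rw [conjK_affineGroup]
  simp only [multiplier_odd_mul]

theorem conjK_affineGroup_odd_zero (e : C n) (k : ℕ) :
    conjK (affineGroup (oddMultiplier e 0)) k = affineGroup (oddMultiplier e k) := by
  rw [oddMultiplier, conjK_affineGroup_multiplier, oddMultiplier, mul_zero, zero_add, one_mul]

theorem NP_eq (n k : ℕ) : NP n k = affineGroup (oddMultiplier 0 k) := by
  rw [NP, gammaP_eq]
  exact conjK_affineGroup_odd_zero 0 k

theorem NM_eq (hn : 4 ≤ n) (k : ℕ) : NM n k = affineGroup (oddMultiplier 1 k) := by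
  rw [NM, gammaM_eq hn]
  exact conjK_affineGroup_odd_zero 1 k

theorem NC_eq {u : ℕ} (hu : 2 ≤ u) (k : ℕ) :
    NC n u k = affineGroup (cyclicMultiplier (2 ^ (u - 2) * (2 * k + 1))) := by
  rw [NC, gammaC_eq hu, cyclicMultiplier, cyclicMultiplier, ← mul_assoc]
  exact conjK_affineGroup_multiplier _ _ k

theorem affineGroup_cyclic_eq_iff {t s : C n} :
    affineGroup (cyclicMultiplier t) = affineGroup (cyclicMultiplier s) ↔ 4 * t = 4 * s := by
  rw [(isMultiplier_cyclic t).affineGroup_eq_iff (isMultiplier_cyclic s), cyclicMultiplier_eq_iff]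

theorem affineGroup_odd_eq_iff {e t t' : C n} :
    affineGroup (oddMultiplier e t) = affineGroup (oddMultiplier e t') ↔ 4 * t = 4 * t' := by
  rw [(isMultiplier_odd e t).affineGroup_eq_iff (isMultiplier_odd e t'), oddMultiplier_right_inj]

theorem affineGroup_exceptional_eq_iff {i j i' j' : C n} :
    affineGroup (exceptionalMultiplier i j) = affineGroup (exceptionalMultiplier i' j') ↔
      8 * sixteenth n * i = 8 * sixteenth n * i' ∧
        8 * sixteenth n * j = 8 * sixteenth n * j' := by
  rw [(isMultiplier_exceptional i j).affineGroup_eq_iff (isMultiplier_exceptional i' j'),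
    exceptionalMultiplier_eq_iff]

theorem affineGroup_cyclic_two_pow_mul_eq_iff {u v : ℕ} (hu : 2 ≤ u) (hv : 2 ≤ v) {x y : C n} :
    affineGroup (cyclicMultiplier (2 ^ (u - 2) * x)) =
      affineGroup (cyclicMultiplier (2 ^ (v - 2) * y)) ↔ 2 ^ u * x = 2 ^ v * y := by
  rw [affineGroup_cyclic_eq_iff, four_mul_two_pow_sub_two_mul hu, four_mul_two_pow_sub_two_mul hv]

theorem NP_eq_NP_iff (k h : ℕ) : NP n k = NP n h ↔ k ≡ h [MOD 2 ^ (n - 2)] := by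
  rw [NP_eq, NP_eq, affineGroup_odd_eq_iff, ← two_pow_mul_natCast_eq_iff]
  norm_num

theorem NM_eq_NM_iff (hn : 4 ≤ n) (k h : ℕ) : NM n k = NM n h ↔ k ≡ h [MOD 2 ^ (n - 2)] := by
  rw [NM_eq hn, NM_eq hn, affineGroup_odd_eq_iff, ← two_pow_mul_natCast_eq_iff]
  norm_num

theorem two_pow_mul_odd_ne_of_lt {u v : ℕ} (huv : u < v) (hu : u < n) (x y : C n) :
    2 ^ u * (2 * x + 1) ≠ 2 ^ v * y := by
  intro h
  obtain ⟨i, rfl⟩ := Nat.exists_eq_add_of_lt huv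
  refine two_pow_ne_zero hu (eq_zero_of_mul_odd (x - 2 ^ i * y) ?_)
  rw [pow_succ, pow_add] at h
  linear_combination h

theorem NC_eq_NC_iff {u v : ℕ} (k h : ℕ) (hu : 2 ≤ u) (hun : u ≤ n) (hv : 2 ≤ v)
    (hvn : v ≤ n) : NC n u k = NC n v h ↔ u = v ∧ k ≡ h [MOD 2 ^ (n - u - 1)] := by
  rw [NC_eq hu, NC_eq hv, affineGroup_cyclic_two_pow_mul_eq_iff hu hv, Nat.sub_sub,
    ← two_pow_mul_natCast_eq_iff, pow_succ]
  constructor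
  · intro heq
    obtain rfl : u = v := by
      rcases lt_trichotomy u v with huv | huv | huv
      · exact (two_pow_mul_odd_ne_of_lt huv (by omega) _ _ heq).elim
      · exact huv
      · exact (two_pow_mul_odd_ne_of_lt huv (by omega) _ _ heq.symm).elim
    exact ⟨rfl, by linear_combination heq⟩
  · rintro ⟨rfl, heq⟩
    linear_combination heq

theorem NC_top (hn : 4 ≤ n) (k : ℕ) : NC n n k = N1 n := by
  rw [NC_eq (by omega), N1_eq, affineGroup_cyclic_eq_iff, four_mul_two_pow_sub_two_mul (by omega),
    two_pow_self_eq_zero]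
  ring

theorem NC_pred (hn : 4 ≤ n) (k : ℕ) : NC n (n - 1) k = N2 n := by
  rw [NC_eq (by omega), N2_eq hn, affineGroup_cyclic_eq_iff,
    four_mul_two_pow_sub_two_mul (by omega), two_pow_sub_one hn]
  linear_combination k * sixteen_mul_sixteenth n

theorem isCyclic_NC {u : ℕ} (hu : 2 ≤ u) (k : ℕ) : IsCyclic (NC n u k) := by
  rw [NC_eq hu]
  refine (isMultiplier_cyclic _).isCyclic_affineGroup (d := 2 ^ (u - 2) * (2 * k + 1)) ?_
  rw [cyclicMultiplier, multiplier_one]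
  ring

theorem nodup_exceptional (hn : 4 ≤ n) : [N3 n, N4 n, N5 n, N6 n].Nodup := by
  have hne := eight_mul_sixteenth_ne_zero hn
  simp [N3_eq hn, N4_eq, N5_eq hn, N6_eq hn, affineGroup_exceptional_eq_iff, hne, hne.symm]

end ListedGroups

section Vertices

variable {n : ℕ} {N : Subgroup (Perm (C n))}

theorem exists_natCast_lt_two_pow_mul_eq {j : ℕ} (hj : 1 ≤ j) (t : C n) :
    ∃ k : ℕ, k < 2 ^ (n - 1) ∧ 2 ^ j * t = 2 ^ j * (k : C n) := by
  obtain ⟨m, rfl⟩ := ZMod.natCast_zmod_surjective t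
  refine ⟨m % 2 ^ (n - 1), Nat.mod_lt _ (by positivity), ?_⟩
  rw [two_pow_mul_natCast_eq_iff]
  exact ((Nat.mod_modEq m (2 ^ (n - 1))).of_dvd (pow_dvd_pow 2 (by omega))).symm

theorem exists_natCast_lt_affineGroup_odd_eq (e t : C n) :
    ∃ k : ℕ, k < 2 ^ (n - 1) ∧
      affineGroup (oddMultiplier e t) = affineGroup (oddMultiplier e (k : C n)) := by
  obtain ⟨k, hk, h⟩ := exists_natCast_lt_two_pow_mul_eq one_le_two t
  exact ⟨k, hk, affineGroup_odd_eq_iff.2 (by linear_combination h)⟩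

theorem mem_familyP_iff : N ∈ familyP n ↔ ∃ t, N = affineGroup (oddMultiplier 0 t) := by
  constructor
  · rintro ⟨k, -, rfl⟩
    exact ⟨k, NP_eq n k⟩
  · rintro ⟨t, rfl⟩
    obtain ⟨k, hk, h⟩ := exists_natCast_lt_affineGroup_odd_eq 0 t
    exact ⟨k, hk, h.trans (NP_eq n k).symm⟩

theorem mem_familyM_iff (hn : 4 ≤ n) :
    N ∈ familyM n ↔ ∃ t, N = affineGroup (oddMultiplier 1 t) := by
  constructor
  · rintro ⟨k, -, rfl⟩
    exact ⟨k, NM_eq hn k⟩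
  · rintro ⟨t, rfl⟩
    obtain ⟨k, hk, h⟩ := exists_natCast_lt_affineGroup_odd_eq 1 t
    exact ⟨k, hk, h.trans (NM_eq hn k).symm⟩

theorem mem_familyP_or_mem_familyM_iff (hn : 4 ≤ n) :
    N ∈ familyP n ∨ N ∈ familyM n ↔ ∃ e t, N = affineGroup (oddMultiplier e t) := by
  rw [mem_familyP_iff, mem_familyM_iff hn]
  constructor
  · rintro (⟨t, h⟩ | ⟨t, h⟩)
    · exact ⟨0, t, h⟩
    · exact ⟨1, t, h⟩
  · rintro ⟨e, t, rfl⟩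
    rcases even_or_odd e with ⟨f, rfl⟩ | ⟨f, rfl⟩
    · exact .inl ⟨_, by rw [← zero_add (2 * f), oddMultiplier_add_two_mul]⟩
    · exact .inr ⟨_, by rw [add_comm (2 * f), oddMultiplier_add_two_mul]⟩

theorem exists_two_pow_mul_odd_eq {w : ℕ} (hw : w ≤ n) (y : C n) :
    ∃ u k : ℕ, w ≤ u ∧ u ≤ n ∧ k < 2 ^ (n - 1) ∧ 2 ^ w * y = 2 ^ u * (2 * (k : C n) + 1) := by
  by_cases h0 : 2 ^ w * y = 0
  · exact ⟨n, 0, hw, le_rfl, by positivity, by rw [h0, two_pow_self_eq_zero, zero_mul]⟩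
  obtain ⟨m, rfl⟩ := ZMod.natCast_zmod_surjective y
  have hm : m ≠ 0 := by
    rintro rfl
    exact h0 (by rw [Nat.cast_zero, mul_zero])
  obtain ⟨v, _, ⟨l, rfl⟩, rfl⟩ := Nat.exists_eq_two_pow_mul_odd hm
  have hodd : (2 : C n) ^ w * (2 ^ v * (2 * l + 1) : ℕ) = 2 ^ (w + v) * (2 * l + 1) := by
    push_cast
    ring
  obtain ⟨k, hk, hkl⟩ := exists_natCast_lt_two_pow_mul_eq (j := w + v + 1) (by omega) (l : C n)
  refine ⟨w + v, k, by omega, ?_, hk, ?_⟩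
  · by_contra! h
    refine h0 ?_
    rw [hodd, pow_eq_zero_of_le h.le (two_pow_self_eq_zero n), zero_mul]
  · rw [hodd]
    linear_combination hkl

theorem exists_NC_iff {w : ℕ} (hw2 : 2 ≤ w) (hw : w ≤ n) :
    (∃ u k, w ≤ u ∧ u ≤ n ∧ k < 2 ^ (n - 1) ∧ N = NC n u k) ↔
      ∃ t, N = affineGroup (cyclicMultiplier (2 ^ (w - 2) * t)) := by
  constructor
  · rintro ⟨u, k, hu, -, -, rfl⟩
    refine ⟨2 ^ (u - w) * (2 * k + 1), ?_⟩
    rw [NC_eq (hw2.trans hu), ← mul_assoc, ← pow_add]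
    congr 4
    omega
  · rintro ⟨t, rfl⟩
    obtain ⟨u, k, hu, hun, hk, h⟩ := exists_two_pow_mul_odd_eq hw t
    refine ⟨u, k, hu, hun, hk, ?_⟩
    rw [NC_eq (hw2.trans hu), affineGroup_cyclic_two_pow_mul_eq_iff hw2 (hw2.trans hu), h]

theorem mem_familyC_iff (hn : 4 ≤ n) :
    N ∈ familyC n ↔ ∃ t, N = affineGroup (cyclicMultiplier t) := by
  have h := exists_NC_iff (N := N) le_rfl (by omega : 2 ≤ n)
  simp only [Nat.sub_self, pow_zero, one_mul] at h
  exact h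

theorem parity_eq_zero_or_one (x : C n) : parity x = 0 ∨ parity x = 1 := by
  rw [parity]
  rcases Nat.mod_two_eq_zero_or_one x.val with h | h <;> simp [h]

theorem eight_mul_sixteenth_mul_parity (x : C n) :
    8 * sixteenth n * parity x = 8 * sixteenth n * x := by
  obtain ⟨y, hy⟩ := exists_eq_parity_add_two_mul x
  linear_combination (-8 * sixteenth n) * hy - y * sixteen_mul_sixteenth n

theorem mem_exceptional_iff (hn : 4 ≤ n) :
    N ∈ ({N3 n, N4 n, N5 n, N6 n} : Set (Subgroup (Perm (C n)))) ↔
      ∃ i j, N = affineGroup (exceptionalMultiplier i j) := by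
  simp only [Set.mem_insert_iff, Set.mem_singleton_iff, N3_eq hn, N4_eq, N5_eq hn, N6_eq hn]
  constructor
  · rintro (h | h | h | h) <;> exact ⟨_, _, h⟩
  · rintro ⟨i, j, rfl⟩
    rw [← affineGroup_exceptional_eq_iff.2
      ⟨eight_mul_sixteenth_mul_parity i, eight_mul_sixteenth_mul_parity j⟩]
    rcases parity_eq_zero_or_one i with hi | hi <;>
      rcases parity_eq_zero_or_one j with hj | hj <;>
      simp [hi, hj]

theorem N1_mem_familyC (hn : 4 ≤ n) : N1 n ∈ familyC n :=
  (mem_familyC_iff hn).2 ⟨_, N1_eq n⟩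

theorem N2_mem_familyC (hn : 4 ≤ n) : N2 n ∈ familyC n :=
  (mem_familyC_iff hn).2 ⟨_, N2_eq hn⟩

theorem regularSubgroups_eq (hn : 4 ≤ n) :
    regularSubgroups (C n) =
      {N1 n, N2 n, N3 n, N4 n, N5 n, N6 n} ∪ familyP n ∪ familyM n ∪ familyC n := by
  ext N
  rw [mem_regularSubgroups_iff_cyclic_or_odd_or_exceptional hn, ← mem_familyC_iff hn,
    ← mem_familyP_or_mem_familyM_iff hn, ← mem_exceptional_iff hn]
  simp only [Set.mem_union, Set.mem_insert_iff, Set.mem_singleton_iff]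
  constructor
  · rintro (h | (h | h) | h | h | h | h) <;> simp only [h, true_or, or_true]
  · rintro ((((rfl | rfl | h) | h) | h) | h)
    · exact .inl (N1_mem_familyC hn)
    · exact .inl (N2_mem_familyC hn)
    · exact .inr (.inr h)
    · exact .inr (.inl (.inl h))
    · exact .inr (.inl (.inr h))
    · exact .inl h

theorem oddMultiplier_zero_ne_oddMultiplier_one (hn : 4 ≤ n) (t t' : C n) :
    oddMultiplier 0 t ≠ oddMultiplier 1 t' := by
  rw [Ne, oddMultiplier_eq_iff]
  exact fun h => eight_mul_sixteenth_ne_zero hn (by linear_combination h.1 - 2 * h.2)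

theorem pairwise_disjoint_families (hn : 4 ≤ n) :
    [{N3 n, N4 n, N5 n, N6 n}, familyP n, familyM n, familyC n].Pairwise Disjoint := by
  simp only [List.pairwise_cons, List.mem_cons, List.not_mem_nil, or_false, forall_eq_or_imp,
    forall_eq, Set.disjoint_left, mem_familyP_iff, mem_familyM_iff hn, mem_familyC_iff hn,
    mem_exceptional_iff hn, IsEmpty.forall_iff, implies_true, List.Pairwise.nil, and_true]
  refine ⟨⟨?_, ?_, ?_⟩, ⟨?_, ?_⟩, ?_⟩
  · rintro _ ⟨i, j, rfl⟩ ⟨t, h⟩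
    rw [(isMultiplier_exceptional i j).affineGroup_eq_iff (isMultiplier_odd 0 t)] at h
    exact oddMultiplier_ne_exceptionalMultiplier hn _ _ _ _ h.symm
  · rintro _ ⟨i, j, rfl⟩ ⟨t, h⟩
    rw [(isMultiplier_exceptional i j).affineGroup_eq_iff (isMultiplier_odd 1 t)] at h
    exact oddMultiplier_ne_exceptionalMultiplier hn _ _ _ _ h.symm
  · rintro _ ⟨i, j, rfl⟩ ⟨t, h⟩
    rw [(isMultiplier_exceptional i j).affineGroup_eq_iff (isMultiplier_cyclic t)] at h
    exact cyclicMultiplier_ne_exceptionalMultiplier hn _ _ _ h.symm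
  · rintro _ ⟨s, rfl⟩ ⟨t, h⟩
    rw [(isMultiplier_odd 0 s).affineGroup_eq_iff (isMultiplier_odd 1 t)] at h
    exact oddMultiplier_zero_ne_oddMultiplier_one hn _ _ h
  · rintro _ ⟨s, rfl⟩ ⟨t, h⟩
    rw [(isMultiplier_odd 0 s).affineGroup_eq_iff (isMultiplier_cyclic t)] at h
    exact cyclicMultiplier_ne_oddMultiplier hn _ _ _ h.symm
  · rintro _ ⟨s, rfl⟩ ⟨t, h⟩
    rw [(isMultiplier_odd 1 s).affineGroup_eq_iff (isMultiplier_cyclic t)] at h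
    exact cyclicMultiplier_ne_oddMultiplier hn _ _ _ h.symm

end Vertices

section Cliques

variable {n : ℕ} {N : Subgroup (Perm (C n))}

theorem two_le_ceilHalf (hn : 4 ≤ n) : 2 ≤ ceilHalf n := by
  rw [ceilHalf]
  omega

theorem ceilHalf_lt (hn : 4 ≤ n) : ceilHalf n < n := by
  rw [ceilHalf]
  omega

theorem mem_cliqueH_iff (hn : 4 ≤ n) :
    N ∈ cliqueH n ↔ ∃ t, N = affineGroup (cyclicMultiplier (2 ^ (ceilHalf n - 2) * t)) :=
  exists_NC_iff (two_le_ceilHalf hn) (ceilHalf_lt hn).le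

theorem N1_mem_cliqueH (hn : 4 ≤ n) : N1 n ∈ cliqueH n :=
  ⟨n, 0, (ceilHalf_lt hn).le, le_rfl, by positivity, (NC_top hn 0).symm⟩

theorem N2_mem_cliqueH (hn : 4 ≤ n) : N2 n ∈ cliqueH n :=
  ⟨n - 1, 0, Nat.le_sub_one_of_lt (ceilHalf_lt hn), n.sub_le 1, by positivity,
    (NC_pred hn 0).symm⟩

theorem ncard_image_Iio {α : Type*} {f : ℕ → α} {m : ℕ} (hf : Set.InjOn f (Set.Iio m)) :
    (f '' Set.Iio m).ncard = m := by
  rw [hf.ncard_image, Set.ncard_Iio_nat]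

theorem cliqueH_eq_image (hn : 4 ≤ n) :
    cliqueH n = (fun j : ℕ => affineGroup (cyclicMultiplier (2 ^ (ceilHalf n - 2) * (j : C n)))) ''
      Set.Iio (2 ^ (n - ceilHalf n)) := by
  ext N
  rw [mem_cliqueH_iff hn]
  constructor
  · rintro ⟨t, rfl⟩
    obtain ⟨m, rfl⟩ := ZMod.natCast_zmod_surjective t
    refine ⟨m % 2 ^ (n - ceilHalf n), Nat.mod_lt _ (by positivity), ?_⟩
    rw [affineGroup_cyclic_two_pow_mul_eq_iff (two_le_ceilHalf hn) (two_le_ceilHalf hn),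
      two_pow_mul_natCast_eq_iff]
    exact Nat.mod_modEq _ _
  · rintro ⟨j, -, rfl⟩
    exact ⟨j, rfl⟩

theorem ncard_cliqueH (hn : 4 ≤ n) : (cliqueH n).ncard = 2 ^ (n - ceilHalf n) := by
  rw [cliqueH_eq_image hn]
  refine ncard_image_Iio fun i hi j hj hij => ?_
  rw [affineGroup_cyclic_two_pow_mul_eq_iff (two_le_ceilHalf hn) (two_le_ceilHalf hn),
    two_pow_mul_natCast_eq_iff] at hij
  exact hij.eq_of_lt_of_lt hi hj

theorem two_mul_lt_of_lt_ceilHalf {u : ℕ} (hu : u < ceilHalf n) : 2 * u < n := by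
  rw [ceilHalf] at hu
  omega

theorem add_mul_lt_two_pow {u t j : ℕ} (hu : 2 * u < n) (ht : t < 2 ^ (n - 2 * u - 1))
    (hj : j < 2 ^ u) : t + 2 ^ (n - 2 * u - 1) * j < 2 ^ (n - u - 1) :=
  calc t + 2 ^ (n - 2 * u - 1) * j
      < 2 ^ (n - 2 * u - 1) + 2 ^ (n - 2 * u - 1) * j := Nat.add_lt_add_right ht _
    _ = 2 ^ (n - 2 * u - 1) * (j + 1) := by ring
    _ ≤ 2 ^ (n - 2 * u - 1) * 2 ^ u := Nat.mul_le_mul_left _ hj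
    _ = 2 ^ (n - u - 1) := by rw [← pow_add]; congr 1; omega

theorem cliqueA_eq_image {u t : ℕ} (hu2 : 2 ≤ u) (hu : 2 * u < n)
    (ht : t < 2 ^ (n - 2 * u - 1)) :
    cliqueA n u t = (fun j => NC n u (t + 2 ^ (n - 2 * u - 1) * j)) '' Set.Iio (2 ^ u) := by
  ext N
  constructor
  · rintro ⟨k, -, hkt, rfl⟩
    have hk : k % 2 ^ (n - 2 * u - 1) = t := by rw [hkt, Nat.mod_eq_of_lt ht]
    refine ⟨k / 2 ^ (n - 2 * u - 1) % 2 ^ u, Nat.mod_lt _ (by positivity),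
      (NC_eq_NC_iff _ _ hu2 (by omega) hu2 (by omega)).2 ⟨rfl, ?_⟩⟩
    rw [show n - u - 1 = n - 2 * u - 1 + u by omega, pow_add]
    conv_rhs => rw [← Nat.mod_add_div k (2 ^ (n - 2 * u - 1)), hk]
    exact (Nat.ModEq.mul_left' _ (Nat.mod_modEq _ _)).add_left t
  · rintro ⟨j, hj, rfl⟩
    refine ⟨t + 2 ^ (n - 2 * u - 1) * j, (add_mul_lt_two_pow hu ht hj).trans_le ?_, ?_, rfl⟩
    · exact Nat.pow_le_pow_right two_pos (by omega)
    · simp [Nat.ModEq]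

theorem ncard_cliqueA {u t : ℕ} (hu2 : 2 ≤ u) (huh : u < ceilHalf n)
    (ht : t < 2 ^ (n - 2 * u - 1)) : (cliqueA n u t).ncard = 2 ^ u := by
  have hu := two_mul_lt_of_lt_ceilHalf huh
  rw [cliqueA_eq_image hu2 hu ht]
  refine ncard_image_Iio fun i hi j hj hij => ?_
  have hmod := ((NC_eq_NC_iff _ _ hu2 (by omega) hu2 (by omega)).1 hij).2
  have heq := hmod.eq_of_lt_of_lt (add_mul_lt_two_pow hu ht hi) (add_mul_lt_two_pow hu ht hj)
  exact Nat.eq_of_mul_eq_mul_left (by positivity) (Nat.add_left_cancel heq)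

theorem cliqueS_eq (hn : 4 ≤ n) (k : ℕ) :
    cliqueS n k = {affineGroup (oddMultiplier 0 (k : C n)),
      affineGroup (oddMultiplier 1 ((k : C n) + sixteenth n)),
      affineGroup (oddMultiplier 0 ((k : C n) + 2 * sixteenth n)),
      affineGroup (oddMultiplier 1 ((k : C n) + 3 * sixteenth n))} := by
  have two_pow_sub_three : (2 : C n) ^ (n - 3) = 2 * sixteenth n := by
    rw [sixteenth, ← pow_succ']
    congr 1
    omega
  rw [cliqueS, NP_eq, NM_eq hn, NP_eq, NM_eq hn]
  push_cast
  rw [two_pow_sub_three, ← sixteenth, add_assoc (k : C n) (2 * sixteenth n),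
    show 2 * sixteenth n + sixteenth n = 3 * sixteenth n by ring]

theorem ncard_cliqueS (hn : 4 ≤ n) (k : ℕ) : (cliqueS n k).ncard = 4 := by
  have ne_of_sub {e s t : C n} (h : 4 * (t - s) = 8 * sixteenth n) :
      affineGroup (oddMultiplier e s) ≠ affineGroup (oddMultiplier e t) := fun heq =>
    eight_mul_sixteenth_ne_zero hn (by linear_combination -h - affineGroup_odd_eq_iff.1 heq)
  have zero_ne_one (s t : C n) :
      affineGroup (oddMultiplier 0 s) ≠ affineGroup (oddMultiplier 1 t) := fun heq =>
    oddMultiplier_zero_ne_oddMultiplier_one hn s t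
      (((isMultiplier_odd 0 s).affineGroup_eq_iff (isMultiplier_odd 1 t)).1 heq)
  rw [cliqueS_eq hn, Set.ncard_insert_of_notMem, Set.ncard_insert_of_notMem,
    Set.ncard_pair (zero_ne_one _ _)]
  · simp only [Set.mem_insert_iff, Set.mem_singleton_iff, not_or]
    exact ⟨(zero_ne_one _ _).symm, ne_of_sub (by ring)⟩
  · simp only [Set.mem_insert_iff, Set.mem_singleton_iff, not_or]
    exact ⟨zero_ne_one _ _, ne_of_sub (by ring), zero_ne_one _ _⟩

theorem mem_cliqueS_iff (hn : 4 ≤ n) (k : ℕ) :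
    N ∈ cliqueS n k ↔
      ∃ e t, 8 * (t + sixteenth n * e) = 8 * k ∧ N = affineGroup (oddMultiplier e t) := by
  have hq := sixteen_mul_sixteenth n
  rw [cliqueS_eq hn]
  constructor
  · rintro (rfl | rfl | rfl | rfl)
    · exact ⟨_, _, by ring, rfl⟩
    · exact ⟨_, _, by linear_combination hq, rfl⟩
    · exact ⟨_, _, by linear_combination hq, rfl⟩
    · exact ⟨_, _, by linear_combination 2 * hq, rfl⟩
  · rintro ⟨e, t, h, rfl⟩
    obtain ⟨z, hz⟩ := exists_eq_of_two_mul_eq_zero hn (x := 4 * (t + sixteenth n * e - k))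
      (by linear_combination h)
    simp only [Set.mem_insert_iff, Set.mem_singleton_iff,
      (isMultiplier_odd _ _).affineGroup_eq_iff (isMultiplier_odd _ _), oddMultiplier_eq_iff]
    rcases even_or_odd e with ⟨f, rfl⟩ | ⟨f, rfl⟩ <;>
      rcases even_or_odd z with ⟨y, rfl⟩ | ⟨y, rfl⟩
    · exact .inl ⟨by linear_combination h - f * hq, by linear_combination hz + y * hq⟩
    · exact .inr (.inr (.inl ⟨by linear_combination h - (f + 1) * hq,
        by linear_combination hz + y * hq⟩))
    · exact .inr (.inr (.inr ⟨by linear_combination h - (f + 2) * hq,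
        by linear_combination hz + (y - 1) * hq⟩))
    · exact .inr (.inl ⟨by linear_combination h - (f + 1) * hq,
        by linear_combination hz + y * hq⟩)

theorem mem_N1_N2_N3_N4_iff (hn : 4 ≤ n) :
    N ∈ ({N1 n, N2 n, N3 n, N4 n} : Set (Subgroup (Perm (C n)))) ↔
      (∃ t, 8 * t = 0 ∧ N = affineGroup (cyclicMultiplier t)) ∨
        ∃ i j, 8 * sixteenth n * i = 0 ∧ N = affineGroup (exceptionalMultiplier i j) := by
  have hq := sixteen_mul_sixteenth n
  simp only [Set.mem_insert_iff, Set.mem_singleton_iff, N1_eq, N2_eq hn, N3_eq hn, N4_eq]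
  constructor
  · rintro (h | h | h | h)
    · exact .inl ⟨_, mul_zero 8, h⟩
    · exact .inl ⟨_, by linear_combination hq, h⟩
    · exact .inr ⟨_, _, mul_zero _, h⟩
    · exact .inr ⟨_, _, mul_zero _, h⟩
  · rintro (⟨t, ht, rfl⟩ | ⟨i, j, hi, rfl⟩)
    · obtain ⟨y, hy⟩ := exists_eq_of_two_mul_eq_zero hn (x := 4 * t) (by linear_combination ht)
      rw [← eight_mul_sixteenth_mul_parity] at hy
      simp only [affineGroup_cyclic_eq_iff, hy]
      rcases parity_eq_zero_or_one y with h | h <;> rw [h]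
      · exact .inl (by ring)
      · exact .inr (.inl (by ring))
    · rw [affineGroup_exceptional_eq_iff.2 ⟨hi.trans (mul_zero _).symm,
        (eight_mul_sixteenth_mul_parity j).symm⟩]
      rcases parity_eq_zero_or_one j with h | h <;> simp [h]

end Cliques

section MutualNormality

/-- Two permutation groups normalize each other; for distinct vertices of the local normalizing
graph this is adjacency. -/
def MutuallyNormal {X : Type*} (N M : Subgroup (Perm X)) : Prop :=
  N ≤ Subgroup.normalizer (M : Set (Perm X)) ∧ M ≤ Subgroup.normalizer (N : Set (Perm X))

theorem MutuallyNormal.symm {X : Type*} {N M : Subgroup (Perm X)} (h : MutuallyNormal N M) :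
    MutuallyNormal M N :=
  And.symm h

variable {n : ℕ}

theorem mutuallyNormal_multiplier_iff {w b w' b' : C n} (hc : IsMultiplier (multiplier w b))
    (hc' : IsMultiplier (multiplier w' b')) :
    MutuallyNormal (affineGroup (multiplier w b)) (affineGroup (multiplier w' b')) ↔
      (8 * (b' * w) = 0 ∧ 4 * (b' * (b + w - (b' + w'))) = 0) ∧
        8 * (b * w') = 0 ∧ 4 * (b * (b' + w' - (b + w))) = 0 := by
  rw [MutuallyNormal, affineGroup_multiplier_le_normalizer_iff hc' hc,
    affineGroup_multiplier_le_normalizer_iff hc hc']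

theorem mutuallyNormal_cyclic_iff {t s : C n} :
    MutuallyNormal (affineGroup (cyclicMultiplier t)) (affineGroup (cyclicMultiplier s)) ↔
      4 * s * (4 * t - 4 * s) = 0 ∧ 4 * t * (4 * s - 4 * t) = 0 := by
  rw [cyclicMultiplier, cyclicMultiplier,
    mutuallyNormal_multiplier_iff (isMultiplier_cyclic t) (isMultiplier_cyclic s)]
  exact ⟨fun h => ⟨by linear_combination h.1.2, by linear_combination h.2.2⟩,
    fun h => ⟨⟨by ring, by linear_combination h.1⟩, by ring, by linear_combination h.2⟩⟩

theorem not_mutuallyNormal_cyclic_odd (hn : 4 ≤ n) (s e t : C n) :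
    ¬ MutuallyNormal (affineGroup (cyclicMultiplier s)) (affineGroup (oddMultiplier e t)) := by
  rw [cyclicMultiplier, oddMultiplier,
    mutuallyNormal_multiplier_iff (isMultiplier_cyclic s) (isMultiplier_odd e t)]
  rintro ⟨⟨-, h⟩, -⟩
  have four_mul_odd : (4 : C n) * (2 * (s - t - sixteenth n * e - 1) + 1) = 0 :=
    eq_zero_of_mul_odd t (by linear_combination h)
  exact eight_ne_zero hn (by linear_combination 2 * eq_zero_of_mul_odd _ four_mul_odd)

theorem mutuallyNormal_cyclic_exceptional_iff {t i j : C n} :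
    MutuallyNormal (affineGroup (cyclicMultiplier t)) (affineGroup (exceptionalMultiplier i j)) ↔
      8 * t = 0 ∧ 8 * sixteenth n * i = 0 := by
  rw [cyclicMultiplier, exceptionalMultiplier,
    mutuallyNormal_multiplier_iff (isMultiplier_cyclic t) (isMultiplier_exceptional i j)]
  constructor
  · rintro ⟨⟨-, hi⟩, -, ht⟩
    exact ⟨eq_zero_of_mul_odd (2 * sixteenth n * j - t - 1) (by linear_combination ht),
      eq_zero_of_mul_odd (t - 2 * sixteenth n * j) (by linear_combination hi)⟩
  · rintro ⟨ht, hi⟩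
    refine ⟨⟨by ring, ?_⟩, ?_, ?_⟩
    · linear_combination (2 * t - 4 * sixteenth n * j + 1) * hi
    · linear_combination 2 * (4 * sixteenth n * j - 1 - 2 * sixteenth n * i) * ht
    · linear_combination (4 * sixteenth n * j - 1 - 2 * t) * ht

theorem mutuallyNormal_odd_iff {e t e' t' : C n} :
    MutuallyNormal (affineGroup (oddMultiplier e t)) (affineGroup (oddMultiplier e' t')) ↔
      8 * (t + sixteenth n * e) = 8 * (t' + sixteenth n * e') := by
  rw [oddMultiplier, oddMultiplier,
    mutuallyNormal_multiplier_iff (isMultiplier_odd e t) (isMultiplier_odd e' t')]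
  have hq := sixteen_mul_sixteenth n
  constructor
  · rintro ⟨⟨-, h⟩, -⟩
    exact sub_eq_zero.1 (eq_zero_of_mul_odd t' (by linear_combination h))
  · intro h
    refine ⟨⟨?_, ?_⟩, ?_, ?_⟩
    · linear_combination (2 * t' + 1) * e * hq
    · linear_combination (2 * t' + 1) * h
    · linear_combination (2 * t + 1) * e' * hq
    · linear_combination -(2 * t + 1) * h

theorem not_mutuallyNormal_odd_exceptional (hn : 4 ≤ n) (e t i j : C n) :
    ¬ MutuallyNormal (affineGroup (oddMultiplier e t))
      (affineGroup (exceptionalMultiplier i j)) := by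
  rw [oddMultiplier, exceptionalMultiplier,
    mutuallyNormal_multiplier_iff (isMultiplier_odd e t) (isMultiplier_exceptional i j)]
  rintro ⟨-, h, -⟩
  have eight_mul_odd : (8 : C n) * (2 * (2 * sixteenth n * j - 1 - sixteenth n * i) + 1) = 0 :=
    eq_zero_of_mul_odd t (by linear_combination h)
  exact eight_ne_zero hn (eq_zero_of_mul_odd _ eight_mul_odd)

theorem mutuallyNormal_exceptional (i j i' j' : C n) :
    MutuallyNormal (affineGroup (exceptionalMultiplier i j))
      (affineGroup (exceptionalMultiplier i' j')) := by
  have hq := sixteen_mul_sixteenth n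
  refine (mutuallyNormal_multiplier_iff (isMultiplier_exceptional i j)
    (isMultiplier_exceptional i' j')).2 ⟨⟨?_, ?_⟩, ?_, ?_⟩
  · linear_combination i' * (4 * sixteenth n * j - 1 - 2 * sixteenth n * i) * hq
  · linear_combination 2 * i' * sixteenth n * (j - j') * hq
  · linear_combination i * (4 * sixteenth n * j' - 1 - 2 * sixteenth n * i') * hq
  · linear_combination 2 * i * sixteenth n * (j' - j) * hq

theorem mutuallyNormal_NC_iff {u v k h : ℕ} (hu : 2 ≤ u) (hv : 2 ≤ v) :
    MutuallyNormal (NC n u k) (NC n v h) ↔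
      (2 : C n) ^ v * (2 ^ u * (2 * k + 1) - 2 ^ v * (2 * h + 1)) = 0 ∧
        (2 : C n) ^ u * (2 ^ v * (2 * h + 1) - 2 ^ u * (2 * k + 1)) = 0 := by
  rw [NC_eq hu, NC_eq hv, mutuallyNormal_cyclic_iff, four_mul_two_pow_sub_two_mul hu,
    four_mul_two_pow_sub_two_mul hv, mul_right_comm, mul_right_comm (2 ^ u),
    (isUnit_two_mul_add_one _).mul_left_eq_zero, (isUnit_two_mul_add_one _).mul_left_eq_zero]

end MutualNormality

section Edges

variable {n : ℕ} {N M : Subgroup (Perm (C n))}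

theorem mutuallyNormal_of_mem_N1_N2_N3_N4 (hn : 4 ≤ n)
    (hN : N ∈ ({N1 n, N2 n, N3 n, N4 n} : Set (Subgroup (Perm (C n)))))
    (hM : M ∈ ({N1 n, N2 n, N3 n, N4 n} : Set (Subgroup (Perm (C n))))) : MutuallyNormal N M := by
  rw [mem_N1_N2_N3_N4_iff hn] at hN hM
  rcases hN with ⟨t, ht, rfl⟩ | ⟨i, j, hi, rfl⟩ <;>
    rcases hM with ⟨s, hs, rfl⟩ | ⟨i', j', hi', rfl⟩
  · exact mutuallyNormal_cyclic_iff.2 ⟨by linear_combination 2 * (t - s) * hs,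
      by linear_combination 2 * (s - t) * ht⟩
  · exact mutuallyNormal_cyclic_exceptional_iff.2 ⟨ht, hi'⟩
  · exact (mutuallyNormal_cyclic_exceptional_iff.2 ⟨hs, hi⟩).symm
  · exact mutuallyNormal_exceptional i j i' j'

theorem mutuallyNormal_of_mem_exceptional (hn : 4 ≤ n)
    (hN : N ∈ ({N3 n, N4 n, N5 n, N6 n} : Set (Subgroup (Perm (C n)))))
    (hM : M ∈ ({N3 n, N4 n, N5 n, N6 n} : Set (Subgroup (Perm (C n))))) :
    MutuallyNormal N M := by
  obtain ⟨i, j, rfl⟩ := (mem_exceptional_iff hn).1 hN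
  obtain ⟨i', j', rfl⟩ := (mem_exceptional_iff hn).1 hM
  exact mutuallyNormal_exceptional i j i' j'

theorem mutuallyNormal_of_mem_cliqueH (hn : 4 ≤ n) (hN : N ∈ cliqueH n) (hM : M ∈ cliqueH n) :
    MutuallyNormal N M := by
  obtain ⟨t, rfl⟩ := (mem_cliqueH_iff hn).1 hN
  obtain ⟨s, rfl⟩ := (mem_cliqueH_iff hn).1 hM
  have hsq : (2 : C n) ^ ceilHalf n * 2 ^ ceilHalf n = 0 := by
    rw [← pow_add]
    exact pow_eq_zero_of_le (by rw [ceilHalf]; omega) (two_pow_self_eq_zero n)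
  simp only [mutuallyNormal_cyclic_iff, four_mul_two_pow_sub_two_mul (two_le_ceilHalf hn)]
  exact ⟨by linear_combination s * (t - s) * hsq, by linear_combination t * (s - t) * hsq⟩

theorem mutuallyNormal_of_mem_cliqueS (hn : 4 ≤ n) {k : ℕ} (hN : N ∈ cliqueS n k)
    (hM : M ∈ cliqueS n k) : MutuallyNormal N M := by
  obtain ⟨e, t, ht, rfl⟩ := (mem_cliqueS_iff hn k).1 hN
  obtain ⟨e', t', ht', rfl⟩ := (mem_cliqueS_iff hn k).1 hM
  exact mutuallyNormal_odd_iff.2 (ht.trans ht'.symm)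

theorem mutuallyNormal_NC_self_iff {u k h : ℕ} (hu : 2 ≤ u) :
    MutuallyNormal (NC n u k) (NC n u h) ↔ k ≡ h [MOD 2 ^ (n - 2 * u - 1)] := by
  rw [mutuallyNormal_NC_iff hu hu, Nat.sub_sub, ← two_pow_mul_natCast_eq_iff, pow_succ, two_mul u,
    pow_add]
  exact ⟨fun H => by linear_combination H.1,
    fun H => ⟨by linear_combination H, by linear_combination -H⟩⟩

theorem mutuallyNormal_of_mem_cliqueA {u t : ℕ} (hu : 2 ≤ u) (hN : N ∈ cliqueA n u t)
    (hM : M ∈ cliqueA n u t) : MutuallyNormal N M := by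
  obtain ⟨k, -, hk, rfl⟩ := hN
  obtain ⟨h, -, hh, rfl⟩ := hM
  exact (mutuallyNormal_NC_self_iff hu).2 (hk.trans hh.symm)

/-- Two groups lie together in one of the listed cliques. -/
def InCommonClique (N M : Subgroup (Perm (C n))) : Prop := ∃ K ∈ cliques n, N ∈ K ∧ M ∈ K

theorem InCommonClique.symm (h : InCommonClique N M) : InCommonClique M N := by
  obtain ⟨K, hK, hN, hM⟩ := h
  exact ⟨K, hK, hM, hN⟩

theorem InCommonClique.mutuallyNormal (hn : 4 ≤ n) (h : InCommonClique N M) :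
    MutuallyNormal N M := by
  obtain ⟨K, ((rfl | rfl | rfl) | ⟨k, -, rfl⟩) | ⟨u, t, hu, -, -, rfl⟩, hN, hM⟩ := h
  · exact mutuallyNormal_of_mem_N1_N2_N3_N4 hn hN hM
  · exact mutuallyNormal_of_mem_exceptional hn hN hM
  · exact mutuallyNormal_of_mem_cliqueH hn hN hM
  · exact mutuallyNormal_of_mem_cliqueS hn hN hM
  · exact mutuallyNormal_of_mem_cliqueA hu hN hM

theorem two_pow_mul_sub_ne_zero_of_lt {u v : ℕ} (huv : u < v) (hu : 2 * u < n) (x y : C n) :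
    2 ^ u * (2 ^ v * y - 2 ^ u * (2 * x + 1)) ≠ 0 := by
  intro h
  refine two_pow_mul_odd_ne_of_lt (u := u + u) (v := u + v) (by omega) (by omega) x y ?_
  rw [pow_add, pow_add]
  linear_combination -h

theorem MutuallyNormal.inCommonClique_NC {u v k h : ℕ} (hu : 2 ≤ u) (huv : u ≤ v) (hv : v ≤ n)
    (hk : k < 2 ^ (n - 1)) (hh : h < 2 ^ (n - 1)) (H : MutuallyNormal (NC n u k) (NC n v h)) :
    InCommonClique (NC n u k) (NC n v h) := by
  rcases le_or_gt (ceilHalf n) u with hcu | hcu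
  · exact ⟨cliqueH n, .inl (.inl (.inr (.inr rfl))), ⟨u, k, hcu, huv.trans hv, hk, rfl⟩,
      v, h, hcu.trans huv, hv, hh, rfl⟩
  obtain rfl : u = v := huv.eq_of_not_lt fun hlt =>
    two_pow_mul_sub_ne_zero_of_lt hlt (two_mul_lt_of_lt_ceilHalf hcu) _ _
      ((mutuallyNormal_NC_iff hu (hu.trans huv)).1 H).2
  rw [mutuallyNormal_NC_self_iff hu] at H
  exact ⟨cliqueA n u (k % 2 ^ (n - 2 * u - 1)),
    .inr ⟨u, _, hu, hcu, Nat.mod_lt _ (by positivity), rfl⟩,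
    ⟨k, hk, (Nat.mod_modEq _ _).symm, rfl⟩, h, hh, H.symm.trans (Nat.mod_modEq _ _).symm, rfl⟩

theorem MutuallyNormal.inCommonClique_of_mem_familyC (hN : N ∈ familyC n) (hM : M ∈ familyC n)
    (H : MutuallyNormal N M) : InCommonClique N M := by
  obtain ⟨u, k, hu, hun, hk, rfl⟩ := hN
  obtain ⟨v, h, hv, hvn, hh, rfl⟩ := hM
  rcases le_total u v with huv | hvu
  · exact H.inCommonClique_NC hu huv hvn hk hh
  · exact (H.symm.inCommonClique_NC hv hvu hun hh hk).symm

theorem MutuallyNormal.inCommonClique_odd (hn : 4 ≤ n) {e t e' t' : C n}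
    (H : MutuallyNormal (affineGroup (oddMultiplier e t)) (affineGroup (oddMultiplier e' t'))) :
    InCommonClique (affineGroup (oddMultiplier e t)) (affineGroup (oddMultiplier e' t')) := by
  rw [mutuallyNormal_odd_iff] at H
  obtain ⟨k, hk, h⟩ := exists_natCast_lt_two_pow_mul_eq (n := n) (j := 3) (by decide)
    (t + sixteenth n * e)
  rw [show (2 : C n) ^ 3 = 8 by norm_num] at h
  exact ⟨cliqueS n k, .inl (.inr ⟨k, hk, rfl⟩), (mem_cliqueS_iff hn k).2 ⟨e, t, h, rfl⟩,
    (mem_cliqueS_iff hn k).2 ⟨e', t', H.symm.trans h, rfl⟩⟩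

theorem MutuallyNormal.inCommonClique_cyclic_exceptional (hn : 4 ≤ n) {t i j : C n}
    (H : MutuallyNormal (affineGroup (cyclicMultiplier t))
      (affineGroup (exceptionalMultiplier i j))) :
    InCommonClique (affineGroup (cyclicMultiplier t))
      (affineGroup (exceptionalMultiplier i j)) := by
  rw [mutuallyNormal_cyclic_exceptional_iff] at H
  exact ⟨_, .inl (.inl (.inl rfl)), (mem_N1_N2_N3_N4_iff hn).2 (.inl ⟨t, H.1, rfl⟩),
    (mem_N1_N2_N3_N4_iff hn).2 (.inr ⟨i, j, H.2, rfl⟩)⟩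

theorem inCommonClique_exceptional (hn : 4 ≤ n) (i j i' j' : C n) :
    InCommonClique (affineGroup (exceptionalMultiplier i j))
      (affineGroup (exceptionalMultiplier i' j')) :=
  ⟨_, .inl (.inl (.inr (.inl rfl))), (mem_exceptional_iff hn).2 ⟨i, j, rfl⟩,
    (mem_exceptional_iff hn).2 ⟨i', j', rfl⟩⟩

theorem MutuallyNormal.inCommonClique (hn : 4 ≤ n) (hN : N ∈ regularSubgroups (C n))
    (hM : M ∈ regularSubgroups (C n)) (h : MutuallyNormal N M) : InCommonClique N M := by
  rw [mem_regularSubgroups_iff_cyclic_or_odd_or_exceptional hn] at hN hM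
  rcases hN with hN | ⟨e, t, rfl⟩ | ⟨i, j, rfl⟩ <;>
    rcases hM with hM | ⟨e', t', rfl⟩ | ⟨i', j', rfl⟩
  · exact h.inCommonClique_of_mem_familyC ((mem_familyC_iff hn).2 hN) ((mem_familyC_iff hn).2 hM)
  · obtain ⟨s, rfl⟩ := hN
    exact (not_mutuallyNormal_cyclic_odd hn s e' t' h).elim
  · obtain ⟨s, rfl⟩ := hN
    exact h.inCommonClique_cyclic_exceptional hn
  · obtain ⟨s, rfl⟩ := hM
    exact (not_mutuallyNormal_cyclic_odd hn s e t h.symm).elim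
  · exact h.inCommonClique_odd hn
  · exact (not_mutuallyNormal_odd_exceptional hn e t i' j' h).elim
  · obtain ⟨s, rfl⟩ := hM
    exact (h.symm.inCommonClique_cyclic_exceptional hn).symm
  · exact (not_mutuallyNormal_odd_exceptional hn e' t' i j h.symm).elim
  · exact inCommonClique_exceptional hn i j i' j'

theorem adj_iff (hn : 4 ≤ n) (N M : regularSubgroups (C n)) :
    (localNormalizingGraph (C n)).Adj N M ↔ N ≠ M ∧ ∃ K ∈ cliques n, N.1 ∈ K ∧ M.1 ∈ K :=
  and_congr_right fun _ =>
    ⟨MutuallyNormal.inCommonClique hn N.2 M.2, InCommonClique.mutuallyNormal hn⟩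

end Edges

end CyclicHol

theorem mainTheorem2 (n : ℕ) (hn : 4 ≤ n) :
    -- the listed functions are gamma functions
    (IsGammaFunction (gamma1 n) ∧ IsGammaFunction (gamma2 n) ∧ IsGammaFunction (gamma3 n) ∧
      IsGammaFunction (gamma4 n) ∧ IsGammaFunction (gamma5 n) ∧ IsGammaFunction (gamma6 n) ∧
      IsGammaFunction (gammaP n) ∧ IsGammaFunction (gammaM n) ∧
      ∀ u, 2 ≤ u → u ≤ n → IsGammaFunction (gammaC n u)) ∧
    -- the vertices
    regularSubgroups (C n) =
      {N1 n, N2 n, N3 n, N4 n, N5 n, N6 n} ∪ familyP n ∪ familyM n ∪ familyC n ∧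
    (∀ u k, 2 ≤ u → u ≤ n → IsCyclic (NC n u k)) ∧
    -- coincidences among the names of the vertices: exactly the following
    (∀ k, NC n n k = N1 n) ∧ (∀ k, NC n (n - 1) k = N2 n) ∧
    [N3 n, N4 n, N5 n, N6 n].Nodup ∧
    [{N3 n, N4 n, N5 n, N6 n}, familyP n, familyM n, familyC n].Pairwise Disjoint ∧
    (∀ k h, NP n k = NP n h ↔ k ≡ h [MOD 2 ^ (n - 2)]) ∧
    (∀ k h, NM n k = NM n h ↔ k ≡ h [MOD 2 ^ (n - 2)]) ∧
    (∀ u v k h, 2 ≤ u → u ≤ n → 2 ≤ v → v ≤ n →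
      (NC n u k = NC n v h ↔ u = v ∧ k ≡ h [MOD 2 ^ (n - u - 1)])) ∧
    -- sizes of the cliques
    (N1 n ∈ cliqueH n ∧ N2 n ∈ cliqueH n ∧ (cliqueH n).ncard = 2 ^ (n - ceilHalf n)) ∧
    (∀ k, (cliqueS n k).ncard = 4) ∧
    (∀ u t, 2 ≤ u → u < ceilHalf n → t < 2 ^ (n - 2 * u - 1) →
      (cliqueA n u t).ncard = 2 ^ u) ∧
    -- the edges
    (∀ N M : regularSubgroups (C n), (localNormalizingGraph (C n)).Adj N M ↔
      N ≠ M ∧ ∃ K ∈ cliques n, N.1 ∈ K ∧ M.1 ∈ K) := by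
  exact ⟨isGammaFunction_gamma hn, regularSubgroups_eq hn, fun _ k hu _ => isCyclic_NC hu k,
    NC_top hn, NC_pred hn, nodup_exceptional hn, pairwise_disjoint_families hn, NP_eq_NP_iff,
    NM_eq_NM_iff hn, fun _ _ k h hu hun hv hvn => NC_eq_NC_iff k h hu hun hv hvn,
    ⟨N1_mem_cliqueH hn, N2_mem_cliqueH hn, ncard_cliqueH hn⟩, ncard_cliqueS hn,
    fun _ _ hu huh ht => ncard_cliqueA hu huh ht, adj_iff hn⟩
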